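/- For $n\ge 2$ points $P=\{p_1,\dots,p_n\}$, a distance function is a map $d:P\times P\to\mathbb R_{\ge 0}$ with $d(p_i,p_i)=0$ and $d(p_i,p_j)=d(p_j,p_i)>0$ for $i\ne j$ (no triangle inequality is required). It is in general position if $d(p_i,p_j)\ne d(p_i,p_k)$ for all $i$ and all $j\neq k$. A directed graph $G=(P,E)$ is navigable if for all $p_i\ne p_j$ there is $p_k$ with $(p_i,p_k)\in E$ and $d(p_k,p_j)<d(p_i,p_j)$. Let $N_G(p_i)$ denote the set of out-neighbours of $p_i$ in $G$. Let $\mathsf{OPT}^*$ be the minimum number of edges of a navigable graph on $P$, and let $\mathsf{OPT}_i$ be the minimum size of a solution of the set cover instance with elements $P\setminus\{p_i\}$ and sets $S_{i\to k}=\{p_j\in P\setminus\{p_i\} : d(p_j,p_k)<d(p_j,p_i)\}$, $k\ne i$. The model of computation is a randomized word RAM with words of $O(\log n)$ bits. Arithmetic on words, memory access, drawing a uniformly random integer from $\{0,\dots,m-1\}$ for a word $m$, comparing two words, comparing two distances $d(p_a,p_b)<d(p_{a'},p_{b'})$, and outputting an edge each take unit time. The distances are accessed only through these comparisons. **Theorem.**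 There are constants $A,B,K,a,b$ and a single randomized algorithm (one program for all $n$) such that, for every $n\ge 2$ and every distance function $d$ in general position on $n$ points, the algorithm always halts within $$A\cdot n\,\mathsf{OPT}^*\cdot\log^{a}(n\,\mathsf{OPT}^*)\;\le\; B\cdot n^{2.5}\log^{b}(n^{2.5})$$ steps, that is, in $\tilde O(n\,\mathsf{OPT}^*)\le\tilde O(n^{2.5})$ time, and, with probability at least $1-\frac1{n^2}$, the output graph $G$ is navigable, has at most $K\cdot\mathsf{OPT}^*\cdot\log n$ edges, and satisfies $|N_G(p_i)|\le K\cdot\mathsf{OPT}_i\cdot\log n$ for every point $p_i$. -/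

import Mathlib

namespace NavGraph

/-! ### Distance functions, navigable graphs, and the optimum -/

/-- A distance function on the points `p_0, …, p_{n-1}`: zero on the diagonal, symmetric and
positive off the diagonal. No triangle inequality. -/
structure IsDistance {n : ℕ} (d : Fin n → Fin n → ℝ) : Prop where
  self : ∀ i, d i i = 0
  symm : ∀ i j, d i j = d j i
  pos : ∀ i j, i ≠ j → 0 < d i j

/-- General position: the distances from a point to the other points are pairwise distinct. -/
def GeneralPosition {n : ℕ} (d : Fin n → Fin n → ℝ) : Prop :=
  ∀ i j k, j ≠ k → d i j ≠ d i k

/-- The directed graph with edge set `E` is navigable: every `p_i ≠ p_j` has an out-neighbour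
that is closer to `p_j` than `p_i` is. -/
def Navigable {n : ℕ} (d : Fin n → Fin n → ℝ) (E : Finset (Fin n × Fin n)) : Prop :=
  ∀ i j, i ≠ j → ∃ k, (i, k) ∈ E ∧ d k j < d i j

/-- The out-neighbourhood of `p_i`. -/
def outNbrs {n : ℕ} (E : Finset (Fin n × Fin n)) (i : Fin n) : Finset (Fin n) :=
  Finset.univ.filter fun k => (i, k) ∈ E

/-- The set `S_{i → k}` of the set cover instance of `p_i`: all points `p_j ≠ p_i` that are
closer to `p_k` than to `p_i`. -/
def coverSet {n : ℕ} (d : Fin n → Fin n → ℝ) (i k : Fin n) : Set (Fin n) :=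
  {j | j ≠ i ∧ d j k < d j i}

/-- `N` is a solution of the set cover instance of `p_i`: it selects sets `S_{i → k}`, `k ≠ i`,
whose union contains every point other than `p_i`. -/
def IsCover {n : ℕ} (d : Fin n → Fin n → ℝ) (i : Fin n) (N : Finset (Fin n)) : Prop :=
  i ∉ N ∧ ∀ j, j ≠ i → ∃ k ∈ N, j ∈ coverSet d i k

/-- `OPT_i`: the least size of a solution of the set cover instance of `p_i`. -/
noncomputable def optAt {n : ℕ} (d : Fin n → Fin n → ℝ) (i : Fin n) : ℕ :=
  sInf {m | ∃ N : Finset (Fin n), IsCover d i N ∧ N.card = m}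

/-- `OPT*`: the least number of edges of a navigable graph. -/
noncomputable def optEdges {n : ℕ} (d : Fin n → Fin n → ℝ) : ℕ :=
  sInf {m | ∃ E : Finset (Fin n × Fin n), Navigable d E ∧ E.card = m}

/-! ### A randomized word RAM with a distance comparison oracle

A program is a finite text that does not depend on the input. The machine has registers and an
addressable memory, both holding words, that is, natural numbers; the result of every arithmetic
operation is reduced modulo the word bound `W`. Every instruction, every test and every
sequencing step costs one time unit. The distances are available only through tests that compare
two of them. -/

/-- Arithmetic operations on words. -/
inductive Op
  | add | sub | mul | div

/-- Subtraction is truncated at zero, division rounds down (and gives `0` for the divisor `0`). -/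
def Op.eval : Op → ℕ → ℕ → ℕ
  | .add, x, y => x + y
  | .sub, x, y => x - y
  | .mul, x, y => x * y
  | .div, x, y => x / y

/-- Instructions; all arguments except the constant in `const` name registers. -/
inductive Instr
  /-- `reg r := c` -/
  | const (r c : ℕ)
  /-- `reg r := reg a ∘ reg b` -/
  | arith (o : Op) (r a b : ℕ)
  /-- `reg r := mem (reg a)` -/
  | load (r a : ℕ)
  /-- `mem (reg a) := reg b` -/
  | store (a b : ℕ)
  /-- `reg r :=` a fresh uniformly random number in `{0, …, reg a - 1}` -/
  | rand (r a : ℕ)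
  /-- output the directed edge `(p_{reg a}, p_{reg b})` -/
  | emit (a b : ℕ)

/-- Tests; the arguments name registers. -/
inductive Cond
  /-- `reg a < reg b` -/
  | lt (a b : ℕ)
  /-- `reg a = reg b` -/
  | eq (a b : ℕ)
  /-- `d(p_{reg a}, p_{reg b}) < d(p_{reg a'}, p_{reg b'})` -/
  | distLt (a b a' b' : ℕ)

/-- Programs. -/
inductive Prog
  | instr (i : Instr)
  | seq (p q : Prog)
  | ite (t : Cond) (p q : Prog)
  | loop (t : Cond) (p : Prog)

/-- A configuration: the stack of programs still to be run, the registers, the memory, and the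
edges output so far. -/
structure Config (n : ℕ) where
  todo : List Prog
  reg : ℕ → ℕ
  mem : ℕ → ℕ
  out : Finset (Fin n × Fin n)

/-- A distance comparison that names a point outside the point set evaluates to false. -/
def Cond.Holds {n : ℕ} (d : Fin n → Fin n → ℝ) (reg : ℕ → ℕ) : Cond → Prop
  | .lt a b => reg a < reg b
  | .eq a b => reg a = reg b
  | .distLt a b a' b' => ∃ i j i' j' : Fin n,
      (i : ℕ) = reg a ∧ (j : ℕ) = reg b ∧ (i' : ℕ) = reg a' ∧ (j' : ℕ) = reg b' ∧
        d i j < d i' j'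

/-- The uniform distribution on `{0, …, m - 1}` (and the constant `0` for `m = 0`). -/
noncomputable def uniformBelow : ℕ → PMF ℕ
  | 0 => PMF.pure 0
  | m + 1 => (PMF.uniformOfFintype (Fin (m + 1))).map fun x => (x : ℕ)

open Classical in
/-- Execution of a single instruction with word bound `W`. An `emit` that names a point outside
the point set has no effect. -/
noncomputable def Instr.exec {n : ℕ} (W : ℕ) (s : Config n) : Instr → PMF (Config n)
  | .const r c => PMF.pure { s with reg := Function.update s.reg r (c % W) }
  | .arith o r a b =>
      PMF.pure { s with reg := Function.update s.reg r (o.eval (s.reg a) (s.reg b) % W) }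
  | .load r a => PMF.pure { s with reg := Function.update s.reg r (s.mem (s.reg a)) }
  | .store a b => PMF.pure { s with mem := Function.update s.mem (s.reg a) (s.reg b) }
  | .rand r a => (uniformBelow (s.reg a)).map fun x =>
      { s with reg := Function.update s.reg r x }
  | .emit a b =>
      if h : s.reg a < n ∧ s.reg b < n then
        PMF.pure { s with out := insert (⟨s.reg a, h.1⟩, ⟨s.reg b, h.2⟩) s.out }
      else PMF.pure s

open Classical in
/-- One time step; the machine has halted when the stack is empty. -/
noncomputable def step {n : ℕ} (W : ℕ) (d : Fin n → Fin n → ℝ) (s : Config n) :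
    PMF (Config n) :=
  match s.todo with
  | [] => PMF.pure s
  | .instr i :: r => i.exec W { s with todo := r }
  | .seq p q :: r => PMF.pure { s with todo := p :: q :: r }
  | .ite t p q :: r =>
      PMF.pure { s with todo := (if t.Holds d s.reg then p else q) :: r }
  | .loop t p :: r =>
      PMF.pure { s with todo := if t.Holds d s.reg then p :: .loop t p :: r else r }

/-- The distribution of the configuration after `T` steps from `s`. -/
noncomputable def runFrom {n : ℕ} (W : ℕ) (d : Fin n → Fin n → ℝ) :
    ℕ → Config n → PMF (Config n)
  | 0, s => PMF.pure s
  | T + 1, s => (step W d s).bind (runFrom W d T)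

/-- The initial configuration: register `0` holds `n`, everything else is zero. -/
def initial (n : ℕ) (p : Prog) : Config n where
  todo := [p]
  reg := fun r => if r = 0 then n else 0
  mem := fun _ => 0
  out := ∅

/-- Words of `w * ⌈log₂ n⌉` bits. -/
def wordBound (w n : ℕ) : ℕ := 2 ^ (w * Nat.clog 2 n)

/-- The distribution of the configuration after `T` steps of the program `p` with word size
`w * ⌈log₂ n⌉` on the `n` points with distance function `d`. -/
noncomputable def run {n : ℕ} (p : Prog) (w : ℕ) (d : Fin n → Fin n → ℝ) (T : ℕ) :
    PMF (Config n) :=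
  runFrom (wordBound w n) d T (initial n p)

/-- Whatever the outcomes of the random choices, the program halts within `T` steps. -/
def HaltsWithin {n : ℕ} (p : Prog) (w : ℕ) (d : Fin n → Fin n → ℝ) (T : ℕ) : Prop :=
  ∀ s ∈ (run p w d T).support, s.todo = []

end NavGraph

set_option linter.unusedSimpArgs false

open scoped ENNReal

namespace NavGraph

/-! Navigability splits into one set cover instance per point, and the out-neighbourhoods of any
navigable graph (loops dropped) solve these instances, so ∑ OPT_i ≤ OPT* (`sum_optAt_le`). It
suffices to solve each instance within a factor O(log n), in time about n · OPT_i up to logarithms.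

For a fixed i let U be the set of points not yet covered and k a guess for OPT_i, initially 1. With
L = ⌈log₂ n⌉ and τ = 28 L, a round draws 4kτ random elements of U and scans all points once, picking
every point that covers at least τ sample elements still alive and deleting those elements. Each
pick costs τ sample elements, so there are at most 4k picks. Afterwards no point covers τ alive
elements; hence if kτ of them are left, then OPT_i > k (`lt_optAt`), and doubling k preserves k ≤ 2
OPT_i. Otherwise the picks cover most of the sample. A union bound over all tuples of 4k picks
(`badSum`, `failure_bound`) shows that, except with probability n⁻⁶, they then leave at most half of
U uncovered. So in every good round either U halves or k doubles, which preserves |U| · 2^r ≤ n · k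
(`failInd_roundOk_le`). After R = 2L + 2 rounds 2^R > 2n² forces U = ∅. At most 8 · OPT_i edges are
added per round, which bounds the degrees surely; only navigability is random.

The program is verified by a calculus of expectations. `cost` is the expected value of a function of
the final configuration, with unhalted runs counted as ∞; `Runs` bounds it for a program in front of
an arbitrary continuation, given a bound for the continuation. Setting the bound to ∞ outside a
predicate (`guarded`) makes a finite cost prove that the predicate holds surely, so one bound yields
sure halting, sure degree bounds and the failure probability (`haltsWithin_and_probability`).

For n · OPT* ≤ Õ(n^2.5), a random set of about √n · log n points hits the set of the ⌊√n⌋ + 1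
nearest points of every point. Edges from all points to such a set, together with edges to j from
its nearest points, form a navigable graph (`optEdges_le`). -/

/-- The registers, the memory and the output of a configuration. -/
structure St (n : ℕ) where
  reg : ℕ → ℕ
  mem : ℕ → ℕ
  out : Finset (Fin n × Fin n)

/-- The configuration with a given state and a given stack of programs. -/
def St.cfg {n : ℕ} (σ : St n) (todo : List Prog) : Config n := ⟨todo, σ.reg, σ.mem, σ.out⟩

/-- Assignment to a register. -/
def St.set {n : ℕ} (σ : St n) (r v : ℕ) : St n := ⟨Function.update σ.reg r v, σ.mem, σ.out⟩

/-! ### Expectations under a `PMF` -/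

lemma tsum_pure_mul {α : Type*} (a : α) (h : α → ℝ≥0∞) : ∑' x, PMF.pure a x * h x = h a := by
  rw [tsum_eq_single a]
  · simp
  · intro b hb; simp [hb]

lemma tsum_bind_mul {α β : Type*} (p : PMF α) (f : α → PMF β) (h : β → ℝ≥0∞) :
    ∑' b, p.bind f b * h b = ∑' a, p a * ∑' b, f a b * h b := by
  simp_rw [PMF.bind_apply, ← ENNReal.tsum_mul_right, ← ENNReal.tsum_mul_left]
  rw [ENNReal.tsum_comm]
  simp_rw [mul_assoc]

lemma tsum_map_mul {α β : Type*} (p : PMF α) (f : α → β) (h : β → ℝ≥0∞) :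
    ∑' b, p.map f b * h b = ∑' a, p a * h (f a) := by
  rw [PMF.map, tsum_bind_mul]
  simp only [Function.comp_apply, tsum_pure_mul]

lemma tsum_uniformBelow_mul (u : ℕ) (hu : 0 < u) (h : ℕ → ℝ≥0∞) :
    ∑' x, uniformBelow u x * h x = (∑ a ∈ Finset.range u, h a) / u := by
  obtain ⟨m, rfl⟩ : ∃ m, u = m + 1 := ⟨u - 1, by omega⟩
  rw [uniformBelow, tsum_map_mul]
  change ∑' a, ((PMF.uniformOfFintype (Fin (m + 1))).bind fun a => PMF.pure (a : ℕ)) a * h a = _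
  rw [tsum_bind_mul, tsum_fintype]
  simp only [tsum_pure_mul, PMF.uniformOfFintype_apply, Fintype.card_fin]
  rw [← Finset.mul_sum, Fin.sum_univ_eq_sum_range (fun i => h i), ENNReal.div_eq_inv_mul]

/-! ### Expected cost and proof rules for programs -/

section
variable {n : ℕ} (W : ℕ) (d : Fin n → Fin n → ℝ)

open Classical in
/-- The expected value after `T` steps of `g`, where a computation that has not halted counts
as infinitely expensive. -/
noncomputable def cost (g : Config n → ℝ≥0∞) (T : ℕ) (c : Config n) : ℝ≥0∞ :=
  ∑' s, runFrom W d T c s * (if s.todo = [] then g s else ⊤)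

open Classical in
lemma cost_zero (g : Config n → ℝ≥0∞) (c : Config n) :
    cost W d g 0 c = if c.todo = [] then g c else ⊤ := by
  rw [cost, runFrom, tsum_pure_mul]

lemma cost_succ (g : Config n → ℝ≥0∞) (T : ℕ) (c : Config n) :
    cost W d g (T + 1) c = ∑' s, step W d c s * cost W d g T s := by
  rw [cost, runFrom, tsum_bind_mul]; rfl

lemma step_nil (c : Config n) (h : c.todo = []) : step W d c = PMF.pure c := by
  rw [step, h]

/-- A halted configuration does not change any more, and one that has not halted already costs ∞
after zero further steps. Thus time bounds may be relaxed freely. -/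
lemma cost_succ_le (g : Config n → ℝ≥0∞) (T : ℕ) (c : Config n) :
    cost W d g (T + 1) c ≤ cost W d g T c := by
  induction T generalizing c with
  | zero =>
    by_cases h : c.todo = []
    · rw [cost_succ, step_nil W d c h, tsum_pure_mul]
    · rw [cost_zero, if_neg h]; exact le_top
  | succ T ih =>
    rw [cost_succ W d g (T + 1), cost_succ W d g T]
    exact ENNReal.tsum_le_tsum fun s => mul_le_mul_right (ih s) _

lemma cost_antitone (g : Config n → ℝ≥0∞) (c : Config n) :
    Antitone fun T => cost W d g T c :=
  antitone_nat_of_succ_le fun T => cost_succ_le W d g T c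

/-- Running `p` from `σ` for at most `t` steps has expected cost at most `e`, if the cost from each
state after `p` is at most `post`. -/
def Runs (p : Prog) (t : ℕ) (σ : St n) (post : St n → ℝ≥0∞) (e : ℝ≥0∞) : Prop :=
  ∀ g rest T, (∀ σ' : St n, cost W d g T (σ'.cfg rest) ≤ post σ') →
    cost W d g (T + t) (σ.cfg (p :: rest)) ≤ e

open Classical in
/-- The function that is infinite outside `Q`. -/
noncomputable def guarded (Q : St n → Prop) (b : St n → ℝ≥0∞) (σ : St n) : ℝ≥0∞ :=
  if Q σ then b σ else ⊤

/-- Running `p` from `σ` surely ends within `t` steps in a state satisfying `Q`. -/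
def Det (p : Prog) (t : ℕ) (σ : St n) (Q : St n → Prop) : Prop :=
  ∀ δ, Runs W d p t σ (guarded Q fun _ => δ) δ

variable {W d}

lemma guarded_pos {Q : St n → Prop} {b : St n → ℝ≥0∞} {σ : St n} (h : Q σ) :
    guarded Q b σ = b σ := if_pos h

lemma le_guarded {Q : St n → Prop} {b : St n → ℝ≥0∞} {σ : St n} {e : ℝ≥0∞}
    (h : Q σ → e ≤ b σ) : e ≤ guarded Q b σ := by
  unfold guarded
  split_ifs with hQ
  · exact h hQ
  · exact le_top

lemma Runs.mono {p : Prog} {t t' : ℕ} {σ : St n} {post post' : St n → ℝ≥0∞} {e e' : ℝ≥0∞}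
    (h : Runs W d p t σ post e) (ht : t ≤ t') (hp : ∀ σ', post' σ' ≤ post σ') (he : e ≤ e') :
    Runs W d p t' σ post' e' := fun g rest T H =>
  (cost_antitone W d g _ (by omega : T + t ≤ T + t')).trans
    ((h g rest T fun σ' => (H σ').trans (hp σ')).trans he)

lemma Det.mono {p : Prog} {t t' : ℕ} {σ : St n} {Q Q' : St n → Prop}
    (h : Det W d p t σ Q) (ht : t ≤ t') (hp : ∀ σ', Q σ' → Q' σ') : Det W d p t' σ Q' := fun δ =>
  (h δ).mono ht (fun σ' => le_guarded fun hQ => (guarded_pos (hp σ' hQ)).le) le_rfl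

/-- `Det` holds for every constant δ, so δ can be taken to be the expected bound `e` itself. -/
lemma Det.runs {p : Prog} {t : ℕ} {σ : St n} {Q : St n → Prop} {post : St n → ℝ≥0∞} {e : ℝ≥0∞}
    (h : Det W d p t σ Q) (hp : ∀ σ', Q σ' → post σ' ≤ e) : Runs W d p t σ post e :=
  (h e).mono le_rfl (fun σ' => le_guarded fun hQ => hp σ' hQ) le_rfl

/-- The bound for `q` acts as the postcondition of `p`: `Runs` quantifies over the rest of the
stack, so `q` can be absorbed into it. -/
lemma Runs.seq {p q : Prog} {s t : ℕ} {σ : St n} {mid post : St n → ℝ≥0∞} {e : ℝ≥0∞}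
    (hp : Runs W d p s σ mid e) (hq : ∀ σ', Runs W d q t σ' post (mid σ')) :
    Runs W d (.seq p q) (s + t + 1) σ post e := by
  intro g rest T H
  have : T + (s + t + 1) = (T + t + s) + 1 := by omega
  rw [this, cost_succ]
  change ∑' c, PMF.pure (σ.cfg (p :: q :: rest)) c * _ ≤ _
  rw [tsum_pure_mul]
  exact hp g _ _ fun σ' => hq σ' g rest T H

lemma Det.seq_runs {p q : Prog} {s t : ℕ} {σ : St n} {Q : St n → Prop} {post : St n → ℝ≥0∞}
    {e : ℝ≥0∞} (hp : Det W d p s σ Q) (hq : ∀ σ', Q σ' → Runs W d q t σ' post e) :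
    Runs W d (.seq p q) (s + t + 1) σ post e := by
  classical
  refine Runs.seq (hp e) fun σ' => ?_
  by_cases h : Q σ'
  · rw [guarded_pos h]; exact hq σ' h
  · rw [guarded, if_neg h]; exact fun g rest T _ => le_top

lemma Det.seq {p q : Prog} {s t : ℕ} {σ : St n} {Q Q' : St n → Prop}
    (hp : Det W d p s σ Q) (hq : ∀ σ', Q σ' → Det W d q t σ' Q') :
    Det W d (.seq p q) (s + t + 1) σ Q' := fun δ =>
  hp.seq_runs fun σ' h => hq σ' h δ

lemma Runs.ite {b : Cond} {p q : Prog} {t : ℕ} {σ : St n} {post : St n → ℝ≥0∞} {e : ℝ≥0∞}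
    (hp : b.Holds d σ.reg → Runs W d p t σ post e)
    (hq : ¬ b.Holds d σ.reg → Runs W d q t σ post e) :
    Runs W d (.ite b p q) (t + 1) σ post e := by
  classical
  intro g rest T H
  rw [← add_assoc, cost_succ]
  change ∑' c, PMF.pure (σ.cfg ((if b.Holds d σ.reg then p else q) :: rest)) c * _ ≤ _
  rw [tsum_pure_mul]
  split_ifs with h
  · exact hp h g rest T H
  · exact hq h g rest T H

lemma Det.ite {b : Cond} {p q : Prog} {t : ℕ} {σ : St n} {Q : St n → Prop}
    (hp : b.Holds d σ.reg → Det W d p t σ Q) (hq : ¬ b.Holds d σ.reg → Det W d q t σ Q) :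
    Det W d (.ite b p q) (t + 1) σ Q := fun δ =>
  Runs.ite (fun h => hp h δ) fun h => hq h δ

lemma Runs.loop_false {b : Cond} {p : Prog} {σ : St n} {post : St n → ℝ≥0∞}
    (h : ¬ b.Holds d σ.reg) : Runs W d (.loop b p) 1 σ post (post σ) := by
  classical
  intro g rest T H
  rw [cost_succ]
  change ∑' c, PMF.pure (σ.cfg (if b.Holds d σ.reg then p :: .loop b p :: rest else rest)) c * _ ≤ _
  rw [tsum_pure_mul, if_neg h]
  exact H σ

lemma Runs.loop_true {b : Cond} {p : Prog} {s t : ℕ} {σ : St n} {mid post : St n → ℝ≥0∞}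
    {e : ℝ≥0∞} (h : b.Holds d σ.reg) (hp : Runs W d p s σ mid e)
    (hl : ∀ σ', Runs W d (.loop b p) t σ' post (mid σ')) :
    Runs W d (.loop b p) (s + t + 1) σ post e := by
  classical
  intro g rest T H
  have : T + (s + t + 1) = (T + t + s) + 1 := by omega
  rw [this, cost_succ]
  change ∑' c, PMF.pure (σ.cfg (if b.Holds d σ.reg then p :: .loop b p :: rest else rest)) c * _ ≤ _
  rw [tsum_pure_mul, if_pos h]
  exact hp g _ _ fun σ' => hl σ' g rest T H

open Classical in
/-- The effect of an instruction that draws no random number. -/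
noncomputable def Instr.apply (W : ℕ) (σ : St n) : Instr → St n
  | .const r c => σ.set r (c % W)
  | .arith o r a b => σ.set r (o.eval (σ.reg a) (σ.reg b) % W)
  | .load r a => σ.set r (σ.mem (σ.reg a))
  | .store a b => ⟨σ.reg, Function.update σ.mem (σ.reg a) (σ.reg b), σ.out⟩
  | .rand _ _ => σ
  | .emit a b => ⟨σ.reg, σ.mem,
      if h : σ.reg a < n ∧ σ.reg b < n then
        insert (⟨σ.reg a, h.1⟩, ⟨σ.reg b, h.2⟩) σ.out else σ.out⟩

/-- The instruction draws no random number. -/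
def Instr.IsDet : Instr → Prop
  | .rand _ _ => False
  | _ => True

lemma Det.instr {i : Instr} (hi : i.IsDet) {σ : St n} {Q : St n → Prop} (h : Q (i.apply W σ)) :
    Det W d (.instr i) 1 σ Q := by
  classical
  intro δ g rest T H
  rw [cost_succ]
  change ∑' c, i.exec W (σ.cfg rest) c * _ ≤ _
  have : i.exec W (σ.cfg rest) = PMF.pure ((i.apply W σ).cfg rest) := by
    cases i with
    | rand r a => exact hi.elim
    | emit a b =>
      by_cases h : σ.reg a < n ∧ σ.reg b < n
      · have e : (Instr.emit a b).exec W (σ.cfg rest) = PMF.pure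
            ⟨rest, σ.reg, σ.mem, insert (⟨σ.reg a, h.1⟩, ⟨σ.reg b, h.2⟩) σ.out⟩ := dif_pos h
        rw [e, Instr.apply, dif_pos h]; rfl
      · have e : (Instr.emit a b).exec W (σ.cfg rest) = PMF.pure (σ.cfg rest) := dif_neg h
        rw [e, Instr.apply, dif_neg h]
    | _ => rfl
  rw [this, tsum_pure_mul]
  exact (H _).trans (guarded_pos h).le

lemma Runs.rand {r a : ℕ} {σ : St n} {post : St n → ℝ≥0∞} (ha : 0 < σ.reg a) :
    Runs W d (.instr (.rand r a)) 1 σ post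
      ((∑ x ∈ Finset.range (σ.reg a), post (σ.set r x)) / (σ.reg a : ℕ)) := by
  intro g rest T H
  rw [cost_succ]
  change ∑' c, ((uniformBelow (σ.reg a)).map fun x => (σ.set r x).cfg rest) c * _ ≤ _
  rw [tsum_map_mul, tsum_uniformBelow_mul _ ha fun x => cost W d g T ((σ.set r x).cfg rest)]
  exact ENNReal.div_le_div_right (Finset.sum_le_sum fun x _ => H _) _

/-- A straight-line program. -/
def block : List Instr → Prog
  | [] => .instr (.const 20 0)
  | i :: l => .seq (.instr i) (block l)

/-- The effect of a straight-line program. -/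
noncomputable def applyAll (W : ℕ) (σ : St n) : List Instr → St n
  | [] => σ.set 20 (0 % W)
  | i :: l => applyAll W (i.apply W σ) l

lemma Det.block {l : List Instr} (hl : ∀ i ∈ l, i.IsDet) {σ : St n} {Q : St n → Prop}
    (h : Q (applyAll W σ l)) : Det W d (block l) (2 * l.length + 1) σ Q := by
  induction l generalizing σ with
  | nil => exact Det.instr (by simp [Instr.IsDet]) h
  | cons i l ih =>
    refine (Det.seq (Q := fun σ' => σ' = i.apply W σ) (Det.instr (hl i (by simp)) rfl)
      fun σ' h' => ?_).mono (t := 1 + (2 * l.length + 1) + 1) ?_ fun _ => id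
    · subst h'
      exact ih (fun j hj => hl j (by simp [hj])) h
    · simp; omega

/-- `for c := 0 to lim - 1 do body`; register `1` holds the number one. -/
def forLoop (c lim : ℕ) (body : Prog) : Prog :=
  .seq (.instr (.const c 0))
    (.loop (.lt c lim) (.seq body (.instr (.arith .add c c 1))))

/-- `Inv` is a sure invariant and `B` a potential that may not increase in expectation. Both refer
to the state whose counter is already set to the next value, so the body must leave the counter and
the constant one in register 1 intact. -/
lemma Runs.forLoop {c lim N : ℕ} {body : Prog} {σ : St n} (hN : N < W) (t : ℕ → ℕ)
    (Inv : ℕ → St n → Prop) (B : ℕ → St n → ℝ≥0∞) (h0 : Inv 0 (σ.set c 0))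
    (hc : ∀ j σ', Inv j σ' → σ'.reg c = j ∧ σ'.reg lim = N)
    (hs : ∀ j < N, ∀ σ', Inv j σ' → Runs W d body (t j) σ'
      (guarded (fun σ'' => Inv (j + 1) (σ''.set c (j + 1)) ∧ σ''.reg c = j ∧ σ''.reg 1 = 1)
        fun σ'' => B (j + 1) (σ''.set c (j + 1))) (B j σ')) :
    Runs W d (forLoop c lim body) (∑ j ∈ Finset.range N, (t j + 3) + 3) σ (guarded (Inv N) (B N))
      (B 0 (σ.set c 0)) := by
  classical
  -- Induction on the number m of iterations still to be done; states violating the invariant have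
  -- bound ∞ and need no argument.
  have key : ∀ m ≤ N, ∀ σ', Runs W d (.loop (.lt c lim) (.seq body (.instr (.arith .add c c 1))))
      (∑ j ∈ Finset.Ico (N - m) N, (t j + 3) + 1) σ' (guarded (Inv N) (B N))
        (guarded (Inv (N - m)) (B (N - m)) σ') := by
    intro m
    induction m with
    | zero =>
      intro _ σ'
      by_cases hI : Inv N σ'
      · have h := hc N σ' hI
        have := Runs.loop_false (W := W) (d := d) (b := .lt c lim) (σ := σ')
          (p := .seq body (.instr (.arith .add c c 1))) (post := guarded (Inv N) (B N))
          (by simp [Cond.Holds, h])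
        simpa using this
      · simp only [Nat.sub_zero]
        rw [guarded, if_neg hI]; exact fun g rest T _ => le_top
    | succ m ih =>
      intro hm σ'
      by_cases hI : Inv (N - (m + 1)) σ'
      · have h := hc _ σ' hI
        have e : N - (m + 1) + 1 = N - m := by omega
        rw [guarded_pos hI, Finset.sum_eq_sum_Ico_succ_bot (by omega), e]
        have := Runs.loop_true (W := W) (d := d) (b := .lt c lim) (σ := σ')
          (by simp only [Cond.Holds]; omega)
          (Runs.seq (hs (N - (m + 1)) (by omega) σ' hI) (q := .instr (.arith .add c c 1)) (t := 1)
            (post := guarded (Inv (N - m)) (B (N - m))) fun σ'' => ?_) (ih (by omega))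
        · exact this.mono (by omega) (fun _ => le_rfl) le_rfl
        · by_cases h' : Inv (N - (m + 1) + 1) (σ''.set c (N - (m + 1) + 1)) ∧
            σ''.reg c = N - (m + 1) ∧ σ''.reg 1 = 1
          · rw [guarded_pos h']
            refine Det.runs (Q := fun σ3 => σ3 = σ''.set c (N - (m + 1) + 1))
              (Det.instr (by simp [Instr.IsDet]) ?_) ?_
            · simp only [Instr.apply, Op.eval, h'.2.1, h'.2.2]
              rw [Nat.mod_eq_of_lt (by omega)]
            · rintro σ3 rfl
              rw [e] at h' ⊢
              rw [guarded_pos h'.1]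
          · rw [guarded, if_neg h']; exact fun g rest T _ => le_top
      · rw [guarded, if_neg hI]; exact fun g rest T _ => le_top
  have := Det.seq_runs (W := W) (d := d) (p := .instr (.const c 0)) (σ := σ)
    (Q := fun σ' => σ' = σ.set c 0) (Det.instr (by simp [Instr.IsDet]) (by simp [Instr.apply]))
    (fun σ' h => by
      have := key N le_rfl σ'
      rw [Nat.sub_self] at this
      subst h
      rwa [guarded_pos h0] at this)
  refine this.mono ?_ (fun _ => le_rfl) le_rfl
  rw [← Finset.range_eq_Ico]; omega

lemma Det.forLoop {c lim N : ℕ} {body : Prog} {σ : St n} (hN : N < W) (t : ℕ)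
    (Inv : ℕ → St n → Prop) (h0 : Inv 0 (σ.set c 0))
    (hc : ∀ j σ', Inv j σ' → σ'.reg c = j ∧ σ'.reg lim = N)
    (hs : ∀ j < N, ∀ σ', Inv j σ' → Det W d body t σ'
      (fun σ'' => Inv (j + 1) (σ''.set c (j + 1)) ∧ σ''.reg c = j ∧ σ''.reg 1 = 1)) :
    Det W d (forLoop c lim body) (N * (t + 3) + 3) σ (Inv N) := fun δ => by
  have := Runs.forLoop (W := W) (d := d) hN (fun _ => t) Inv (fun _ _ => δ) h0 hc
    fun j hj σ' h => hs j hj σ' h δ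
  simpa using this

end

/-! ### Subroutines: counting, filtering and sampling -/

section
variable {n : ℕ} {W : ℕ} {d : Fin n → Fin n → ℝ}

lemma St.set_reg (σ : St n) (r v s : ℕ) :
    (σ.set r v).reg s = if s = r then v else σ.reg s := Function.update_apply ..

lemma St.set_mem (σ : St n) (r v : ℕ) : (σ.set r v).mem = σ.mem := rfl

lemma St.set_out (σ : St n) (r v : ℕ) : (σ.set r v).out = σ.out := rfl

/-- The list of `len` words stored from address `b` on. -/
def rd (mem : ℕ → ℕ) (b len : ℕ) : List ℕ := (List.range len).map fun t => mem (b + t)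

@[simp] lemma rd_length (mem : ℕ → ℕ) (b len : ℕ) : (rd mem b len).length = len := by simp [rd]

@[simp] lemma rd_zero (mem : ℕ → ℕ) (b : ℕ) : rd mem b 0 = [] := rfl

lemma rd_succ (mem : ℕ → ℕ) (b len : ℕ) : rd mem b (len + 1) = rd mem b len ++ [mem (b + len)] := by
  simp [rd, List.range_succ]

lemma rd_congr {mem mem' : ℕ → ℕ} {b len : ℕ} (h : ∀ t < len, mem (b + t) = mem' (b + t)) :
    rd mem b len = rd mem' b len :=
  List.map_congr_left fun t ht => h t (List.mem_range.1 ht)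

/-- Point `x` is closer to `y` than to `i`. -/
def Cov (d : Fin n → Fin n → ℝ) (i y x : ℕ) : Prop :=
  ∃ (hi : i < n) (hy : y < n) (hx : x < n), d ⟨x, hx⟩ ⟨y, hy⟩ < d ⟨x, hx⟩ ⟨i, hi⟩

lemma holds_distLt (reg : ℕ → ℕ) (x y i : ℕ) :
    (Cond.distLt x y x i).Holds d reg ↔ Cov d (reg i) (reg y) (reg x) := by
  constructor
  · rintro ⟨a, b, a', b', ha, hb, ha', hb', h⟩
    have e : a' = a := Fin.ext (ha'.trans ha.symm)
    subst e
    exact ⟨hb' ▸ b'.2, hb ▸ b.2, ha ▸ a'.2, by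
      convert h using 2 <;> exact Fin.ext (by simp [*])⟩
  · rintro ⟨hi, hy, hx, h⟩
    exact ⟨⟨_, hx⟩, ⟨_, hy⟩, ⟨_, hx⟩, ⟨_, hi⟩, rfl, rfl, rfl, rfl, h⟩

/-- Counts in register `19` the alive sample elements covered by point `reg 14`. -/
def countProg : Prog :=
  .seq (.instr (.const 19 0)) (forLoop 16 12
    (.seq (block [.arith .add 18 4 16, .load 17 18])
      (.ite (.distLt 17 14 17 6) (block [.arith .add 19 19 1]) (block []))))

open Classical in
lemma det_countProg {σ : St n} (h1 : σ.reg 1 = 1) (hW : σ.reg 4 + σ.reg 12 < W) :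
    Det W d countProg (σ.reg 12 * 13 + 5) σ fun σ' =>
      (∀ r < 16, σ'.reg r = σ.reg r) ∧ σ'.mem = σ.mem ∧ σ'.out = σ.out ∧
        σ'.reg 19 = (rd σ.mem (σ.reg 4) (σ.reg 12)).countP (fun x => Cov d (σ.reg 6) (σ.reg 14) x) := by
  refine (Det.seq (Q := fun σ' => σ' = σ.set 19 0)
    (Det.instr (by simp [Instr.IsDet]) (by simp [Instr.apply])) (t := σ.reg 12 * 13 + 3)
    fun σ' h => ?_).mono (by omega) fun _ => id
  subst h
  refine (Det.forLoop (N := σ.reg 12) (by omega) 10 (fun j σ' => (∀ r < 16, σ'.reg r = σ.reg r) ∧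
    σ'.mem = σ.mem ∧ σ'.out = σ.out ∧ σ'.reg 16 = j ∧ σ'.reg 19 =
      (rd σ.mem (σ.reg 4) j).countP (fun x => Cov d (σ.reg 6) (σ.reg 14) x))
    ?_ ?_ ?_).mono (by omega) ?_
  · refine ⟨fun r hr => ?_, rfl, rfl, ?_, ?_⟩
    · simp [St.set_reg, show r ≠ 16 by omega, show r ≠ 19 by omega]
    · simp [St.set_reg]
    · simp [St.set_reg]
  · rintro j σ' ⟨hf, -, -, h16, -⟩
    exact ⟨h16, hf 12 (by norm_num)⟩
  · rintro j hj σ' ⟨hf, hm, ho, h16, h19⟩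
    have e1 : (σ.reg 4 + j) % W = σ.reg 4 + j := Nat.mod_eq_of_lt (by omega)
    have hcount := rd_succ σ.mem (σ.reg 4) j
    have hle := List.countP_le_length (l := rd σ.mem (σ.reg 4) j)
      (p := fun x => Cov d (σ.reg 6) (σ.reg 14) x)
    rw [rd_length] at hle
    refine Det.seq (s := 5) (t := 4) (Det.block (by simp [Instr.IsDet]) (Q := fun σ2 =>
      σ2 = applyAll W σ' [.arith .add 18 4 16, .load 17 18]) rfl) ?_
    rintro σ2 rfl
    refine Det.ite (t := 3) (fun h => ?_) (fun h => ?_) <;> rw [holds_distLt] at h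
    · refine Det.block (by simp [Instr.IsDet]) ?_
      simp [applyAll, Instr.apply, Op.eval, St.set_reg, St.set_mem, St.set_out, hf, hm, ho, h16, e1,
        h19, h1] at h ⊢
      refine ⟨fun r hr => ?_, ?_⟩
      · simp [show r ≠ 16 by omega, show r ≠ 17 by omega, show r ≠ 18 by omega,
          show r ≠ 19 by omega, show r ≠ 20 by omega, hf r hr]
      · rw [hcount, List.countP_append, Nat.mod_eq_of_lt (by omega)]
        simp [h]
    · refine (Det.block (by simp [Instr.IsDet]) ?_).mono (by simp) fun _ => id
      simp [applyAll, Instr.apply, Op.eval, St.set_reg, St.set_mem, St.set_out, hf, hm, ho, h16, e1,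
        h19, h1] at h ⊢
      refine ⟨fun r hr => ?_, ?_⟩
      · simp [show r ≠ 16 by omega, show r ≠ 17 by omega, show r ≠ 18 by omega,
          show r ≠ 19 by omega, show r ≠ 20 by omega, hf r hr]
      · rw [hcount, List.countP_append]
        simp [h]
  · rintro σ' ⟨hf, hm, ho, -, h19⟩
    exact ⟨hf, hm, ho, h19⟩

/-- Removes from the array at address `reg base` of length `reg size` the elements covered by
point `reg y`. -/
def filterProg (base size y : ℕ) : Prog :=
  .seq (.instr (.const 19 0)) (.seq (forLoop 16 size
    (.seq (block [.arith .add 18 base 16, .load 17 18])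
      (.ite (.distLt 17 y 17 6) (block [])
        (block [.arith .add 18 base 19, .store 18 17, .arith .add 19 19 1]))))
    (block [.arith .add size 19 5]))

open Classical in
-- The array is compacted in place: the write position (register 19) never overtakes the read
-- position (register 16), so the unread entries are still the original ones.
lemma det_filterProg {σ : St n} {base size y : ℕ} (hb : base < 16) (hs : size < 16) (hy : y < 16)
    (h1 : σ.reg 1 = 1) (h5 : σ.reg 5 = 0) (hW : σ.reg base + σ.reg size < W) :
    Det W d (filterProg base size y) (σ.reg size * 17 + 9) σ fun σ' =>
      (∀ r < 16, r ≠ size → σ'.reg r = σ.reg r) ∧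
      (∀ a, a < σ.reg base ∨ σ.reg base + σ.reg size ≤ a → σ'.mem a = σ.mem a) ∧
      σ'.out = σ.out ∧
      rd σ'.mem (σ.reg base) (σ'.reg size) = (rd σ.mem (σ.reg base) (σ.reg size)).filter
        (fun x => ¬ Cov d (σ.reg 6) (σ.reg y) x) := by
  have b16 : base ≠ 16 := by omega
  have b17 : base ≠ 17 := by omega
  have b18 : base ≠ 18 := by omega
  have b19 : base ≠ 19 := by omega
  have b20 : base ≠ 20 := by omega
  have y16 : y ≠ 16 := by omega
  have y17 : y ≠ 17 := by omega
  have y18 : y ≠ 18 := by omega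
  have y20 : y ≠ 20 := by omega
  refine (Det.seq (Q := fun σ' => σ' = σ.set 19 0)
    (Det.instr (by simp [Instr.IsDet]) (by simp [Instr.apply])) (t := σ.reg size * 17 + 7)
    fun σ' h => ?_).mono (by omega) fun _ => id
  subst h
  refine (Det.seq (s := σ.reg size * 17 + 3) (t := 3)
    (Det.forLoop (N := σ.reg size) (by omega) 14
    (fun j σ' => (∀ r < 16, σ'.reg r = σ.reg r) ∧
    (∀ a, a < σ.reg base ∨ σ.reg base + j ≤ a → σ'.mem a = σ.mem a) ∧
     σ'.out = σ.out ∧ σ'.reg 16 = j ∧ 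
      rd σ'.mem (σ.reg base) (σ'.reg 19) = (rd σ.mem (σ.reg base) j).filter
        (fun x => ¬ Cov d (σ.reg 6) (σ.reg y) x))
    ?_ ?_ ?_) ?_).mono (by omega) fun _ => id
  · refine ⟨fun r hr => ?_, fun _ _ => rfl, rfl, ?_, ?_⟩
    · simp [St.set_reg, show r ≠ 16 by omega, show r ≠ 19 by omega]
    · simp [St.set_reg]
    · simp [St.set_reg]
  · rintro j σ' ⟨hf, -, -, h16, -⟩
    exact ⟨h16, hf size hs⟩
  · rintro j hj σ' ⟨hf, hm, ho, h16, hrd⟩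
    have e1 : (σ.reg base + j) % W = σ.reg base + j := Nat.mod_eq_of_lt (by omega)
    have hle : σ'.reg 19 ≤ j := by
      have := congrArg List.length hrd
      rw [rd_length] at this
      rw [this]
      exact (List.length_filter_le _ _).trans (by simp)
    have e2 : (σ.reg base + σ'.reg 19) % W = σ.reg base + σ'.reg 19 := Nat.mod_eq_of_lt (by omega)
    have e3 : (σ'.reg 19 + 1) % W = σ'.reg 19 + 1 := Nat.mod_eq_of_lt (by omega)
    have hmj : σ'.mem (σ.reg base + j) = σ.mem (σ.reg base + j) := hm _ (by omega)
    refine Det.seq (s := 5) (t := 8) (Det.block (by simp [Instr.IsDet]) (Q := fun σ2 =>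
      σ2 = applyAll W σ' [.arith .add 18 base 16, .load 17 18]) rfl) ?_
    rintro σ2 rfl
    refine Det.ite (t := 7) (fun h => ?_) (fun h => ?_) <;> rw [holds_distLt] at h
    · refine (Det.block (by simp [Instr.IsDet]) ?_).mono (by simp) fun _ => id
      simp [applyAll, Instr.apply, Op.eval, St.set_reg, St.set_mem, St.set_out, hf, ho, h16, e1,
        h1, b16, b17, b18, b19, b20, y16, y17, y18, y20, hf base hb, hf y hy, hmj] at h ⊢
      refine ⟨fun r hr => ?_, fun a ha => hm a (by omega), ?_⟩
      · simp [show r ≠ 16 by omega, show r ≠ 17 by omega, show r ≠ 18 by omega,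
          show r ≠ 19 by omega, show r ≠ 20 by omega, hf r hr]
      · rw [hrd, rd_succ, List.filter_append]
        simp [h]
    · refine (Det.block (by simp [Instr.IsDet]) ?_).mono (by simp) fun _ => id
      simp [applyAll, Instr.apply, Op.eval, St.set_reg, St.set_mem, St.set_out, hf, ho, h16, e1, e2,
        e3, h1, b16, b17, b18, b19, b20, y16, y17, y18, y20, hf base hb, hf y hy, hmj] at h ⊢
      refine ⟨fun r hr => ?_, fun a ha => ?_, ?_⟩
      · simp [show r ≠ 16 by omega, show r ≠ 17 by omega, show r ≠ 18 by omega,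
          show r ≠ 19 by omega, show r ≠ 20 by omega, hf r hr]
      · rw [Function.update_of_ne (by omega)]
        exact hm a (by omega)
      · simp only [decide_not] at hrd
        rw [rd_succ, rd_succ, List.filter_append, ← hrd]
        simp [h]
        refine rd_congr fun t ht => ?_
        rw [Function.update_of_ne (by omega)]
  · rintro σ' ⟨hf, hm, ho, -, hrd⟩
    have hle : σ'.reg 19 ≤ σ.reg size := by
      have := congrArg List.length hrd
      rw [rd_length] at this
      rw [this]
      exact (List.length_filter_le _ _).trans (by simp)
    have e1 : (σ'.reg 19) % W = σ'.reg 19 := Nat.mod_eq_of_lt (by omega)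
    refine Det.block (by simp [Instr.IsDet]) ?_
    simp [applyAll, Instr.apply, Op.eval, St.set_reg, St.set_mem, St.set_out, hf, ho, e1, h5,
      show size ≠ 20 by omega] at hrd ⊢
    refine ⟨fun r hr hrs => ?_, hm, hrd⟩
    simp [show r ≠ 20 by omega, hrs, hf r hr]

/-- The expected value of `f` at a list of `m` independent uniformly random elements of `U`. -/
noncomputable def sampleAvg (U : List ℕ) : ℕ → (List ℕ → ℝ≥0∞) → ℝ≥0∞
  | 0, f => f []
  | m + 1, f => (U.map fun x => sampleAvg U m fun l => f (x :: l)).sum / (U.length : ℕ)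

lemma sum_map_range (m : ℕ) (f : ℕ → ℝ≥0∞) :
    ((List.range m).map f).sum = ∑ x ∈ Finset.range m, f x := by
  induction m with
  | zero => simp
  | succ m ih => simp [List.range_succ, Finset.sum_range_succ, ih]

/-- Stores `reg 10` random elements of the array of length `reg 7` at address `0` from address
`reg 4` on. -/
def sampleProg : Prog :=
  forLoop 16 10 (.seq (.instr (.rand 17 7))
    (block [.load 17 17, .arith .add 18 4 16, .store 18 17]))

/-- The potential after j draws is the average of `f` over the remaining draws, with the first j
elements read off from memory; one `rand` unfolds one level of `sampleAvg`. The sample lies beyond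
the array it is drawn from, so stores do not disturb later draws. -/
lemma runs_sampleProg {σ : St n} (h1 : σ.reg 1 = 1) (hu : 0 < σ.reg 7)
    (hu4 : σ.reg 7 ≤ σ.reg 4)
    (hW : σ.reg 4 + σ.reg 10 < W) (post : St n → ℝ≥0∞) (f : List ℕ → ℝ≥0∞)
    (hf : ∀ σ' : St n, (∀ r < 16, σ'.reg r = σ.reg r) → (∀ a < σ.reg 4, σ'.mem a = σ.mem a) →
      σ'.out = σ.out → (∀ x ∈ rd σ'.mem (σ.reg 4) (σ.reg 10), x ∈ rd σ.mem 0 (σ.reg 7)) →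
      post σ' ≤ f (rd σ'.mem (σ.reg 4) (σ.reg 10))) :
    Runs W d sampleProg (σ.reg 10 * 12 + 3) σ post
      (sampleAvg (rd σ.mem 0 (σ.reg 7)) (σ.reg 10) f) := by
  have := Runs.forLoop (W := W) (d := d) (c := 16) (lim := 10) (N := σ.reg 10) (σ := σ)
    (body := .seq (.instr (.rand 17 7)) (block [.load 17 17, .arith .add 18 4 16, .store 18 17]))
    (by omega) (fun _ => 9)
    (fun j σ' => (∀ r < 16, σ'.reg r = σ.reg r) ∧ (∀ a < σ.reg 4, σ'.mem a = σ.mem a) ∧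
      σ'.out = σ.out ∧ σ'.reg 16 = j ∧ ∀ x ∈ rd σ'.mem (σ.reg 4) j, x ∈ rd σ.mem 0 (σ.reg 7))
    (fun j σ' => sampleAvg (rd σ.mem 0 (σ.reg 7)) (σ.reg 10 - j)
      fun l => f (rd σ'.mem (σ.reg 4) j ++ l)) ?_ ?_ ?_
  · refine this.mono ?_ (fun σ' => le_guarded ?_) ?_
    · simp
    · rintro ⟨hr, hm, ho, -, hx⟩
      simpa [sampleAvg] using hf σ' hr hm ho hx
    · simp
  · refine ⟨fun r hr => ?_, fun _ _ => rfl, rfl, ?_, ?_⟩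
    · simp [St.set_reg, show r ≠ 16 by omega]
    · simp [St.set_reg]
    · simp
  · rintro j σ' ⟨hr, -, -, h16, -⟩
    exact ⟨h16, hr 10 (by norm_num)⟩
  · rintro j hj σ' ⟨hr, hm, ho, h16, hx⟩
    have e1 : (σ.reg 4 + j) % W = σ.reg 4 + j := Nat.mod_eq_of_lt (by omega)
    refine (Runs.seq (s := 1) (t := 7) (mid := fun σ2 => guarded (fun σ2 => ∃ x < σ.reg 7,
      σ2 = σ'.set 17 x) (fun σ2 => sampleAvg (rd σ.mem 0 (σ.reg 7)) (σ.reg 10 - (j + 1))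
      fun l => f (rd σ'.mem (σ.reg 4) j ++ σ.mem (σ2.reg 17) :: l)) σ2)
      (Runs.rand (by rw [hr 7 (by norm_num)]; exact hu)) ?_).mono le_rfl (fun _ => le_rfl) ?_
    · intro σ2
      by_cases h : ∃ x < σ.reg 7, σ2 = σ'.set 17 x
      · rw [guarded_pos h]
        obtain ⟨x, hxu, rfl⟩ := h
        have ex : σ'.mem x = σ.mem x := hm x (by omega)
        refine Det.runs (Det.block (by simp [Instr.IsDet]) (Q := fun σ3 =>
          σ3 = applyAll W (σ'.set 17 x) [.load 17 17, .arith .add 18 4 16, .store 18 17]) rfl) ?_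
        rintro σ3 rfl
        have hrd : rd (Function.update σ'.mem (σ.reg 4 + j) (σ.mem x)) (σ.reg 4) (j + 1) =
            rd σ'.mem (σ.reg 4) j ++ [σ.mem x] := by
          rw [rd_succ, Function.update_self]
          congr 1
          exact rd_congr fun t ht => Function.update_of_ne (by omega) _ _
        rw [guarded_pos]
        · simp [applyAll, Instr.apply, Op.eval, St.set_reg, St.set_mem, hr, h16, e1, ex, hrd]
        · simp [applyAll, Instr.apply, Op.eval, St.set_reg, St.set_mem, St.set_out, hr, h16, e1, ex,
            hrd, ho, h1]
          refine ⟨fun r hr' => ?_, fun a ha => ?_, ?_⟩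
          · simp [show r ≠ 16 by omega, show r ≠ 17 by omega, show r ≠ 18 by omega,
              show r ≠ 20 by omega, hr r hr']
          · rw [Function.update_of_ne (by omega), hm a ha]
          · rintro y (hy | rfl)
            · exact hx y hy
            · exact List.mem_map.2 ⟨x, List.mem_range.2 hxu, by simp⟩
      · rw [guarded, if_neg h]; exact fun g rest T _ => le_top
    · obtain ⟨k, hk⟩ : ∃ k, σ.reg 10 - j = k + 1 := ⟨σ.reg 10 - j - 1, by omega⟩
      have hk' : σ.reg 10 - (j + 1) = k := by omega
      rw [hk, hk', sampleAvg, rd_length, hr 7 (by norm_num)]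
      refine ENNReal.div_le_div_right (le_of_eq ?_) _
      rw [rd, List.map_map, sum_map_range]
      refine Finset.sum_congr rfl fun x hx' => ?_
      rw [guarded_pos ⟨x, Finset.mem_range.1 hx', rfl⟩]
      simp [St.set_reg]

end

/-! ### One round: scanning the sample, emitting edges, updating the guess -/

section
variable {n : ℕ} {W : ℕ} {d : Fin n → Fin n → ℝ}

/-- The contents of the registers that stay fixed throughout the main loop. -/
structure Fixed (τ R : ℕ) (σ : St n) : Prop where
  r0 : σ.reg 0 = n
  r1 : σ.reg 1 = 1
  r2 : σ.reg 2 = τ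
  r3 : σ.reg 3 = R
  r4 : σ.reg 4 = 2 * n
  r5 : σ.reg 5 = 0

lemma Fixed.congr {τ R : ℕ} {σ σ' : St n} (h : Fixed τ R σ) (hr : ∀ r < 6, σ'.reg r = σ.reg r) :
    Fixed τ R σ' := by
  constructor <;> rw [hr _ (by norm_num)]
  exacts [h.r0, h.r1, h.r2, h.r3, h.r4, h.r5]

/-- No point of `P` is closer to `x` than `i`. -/
def Unc (d : Fin n → Fin n → ℝ) (i : ℕ) (P : List ℕ) (x : ℕ) : Prop := ∀ p ∈ P, ¬ Cov d i p x

/-- One pass over all points, picking those that cover at least `reg 2` alive sample elements. -/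
def passProg : Prog :=
  forLoop 14 0 (.seq countProg (.ite (.lt 19 2) (block [])
    (.seq (filterProg 4 12 14) (block [.arith .add 18 0 13, .store 18 14, .arith .add 13 13 1]))))

open Classical in
lemma filter_unc_append (i : ℕ) (P : List ℕ) (y : ℕ) (l : List ℕ) :
    l.filter (fun x => Unc d i (P ++ [y]) x) =
      (l.filter fun x => Unc d i P x).filter fun x => ¬ Cov d i y x := by
  rw [List.filter_filter]
  congr 1
  funext x
  rw [Bool.eq_iff_iff, Bool.and_eq_true, decide_eq_true_eq, decide_eq_true_eq, decide_eq_true_eq]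
  simp only [Unc, List.mem_append, List.mem_singleton, or_imp, forall_and, forall_eq, and_comm]

open Classical in
-- Each pick deletes at least τ alive elements, which gives the bound on the number of picks. A
-- single scan suffices because counts only decrease as elements die: a point rejected once stays
-- below τ, and a picked point covers nothing that is left.
lemma det_passProg {σ : St n} {τ R m : ℕ} (hG : Fixed τ R σ) (hτ : 0 < τ) (h12 : σ.reg 12 = m)
    (h13 : σ.reg 13 = 0) (hW : 2 * n + m < W) :
    Det W d passProg (n * (30 * m + 40) + 3) σ fun σ' =>
      (∀ r < 12, σ'.reg r = σ.reg r) ∧ (∀ a < n, σ'.mem a = σ.mem a) ∧ σ'.out = σ.out ∧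
      (∀ p ∈ rd σ'.mem n (σ'.reg 13), p < n) ∧ σ'.reg 13 ≤ n ∧
      rd σ'.mem (2 * n) (σ'.reg 12) = (rd σ.mem (2 * n) m).filter
        (fun x => Unc d (σ.reg 6) (rd σ'.mem n (σ'.reg 13)) x) ∧
      σ'.reg 13 * τ + σ'.reg 12 ≤ m ∧
      ∀ y < n, (rd σ'.mem (2 * n) (σ'.reg 12)).countP (fun x => Cov d (σ.reg 6) y x) < τ := by
  refine (Det.forLoop (N := n) (by omega) (30 * m + 36) (fun j σ' =>
      (∀ r < 12, σ'.reg r = σ.reg r) ∧ (∀ a < n, σ'.mem a = σ.mem a) ∧ σ'.out = σ.out ∧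
      (∀ p ∈ rd σ'.mem n (σ'.reg 13), p < n) ∧ σ'.reg 13 ≤ j ∧
      rd σ'.mem (2 * n) (σ'.reg 12) = (rd σ.mem (2 * n) m).filter
        (fun x => Unc d (σ.reg 6) (rd σ'.mem n (σ'.reg 13)) x) ∧
      σ'.reg 13 * τ + σ'.reg 12 ≤ m ∧
      (∀ y < j, (rd σ'.mem (2 * n) (σ'.reg 12)).countP (fun x => Cov d (σ.reg 6) y x) < τ) ∧
      σ'.reg 14 = j)
    ?_ ?_ ?_).mono (Nat.add_le_add_right (Nat.mul_le_mul_left _ (by omega)) _) ?_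
  · simp [St.set_reg, St.set_mem, St.set_out, h12, h13, Unc]
    intro r hr h
    omega
  · rintro j σ' ⟨hf, -, -, -, -, -, -, -, h14⟩
    exact ⟨h14, (hf 0 (by norm_num)).trans hG.r0⟩
  · rintro j hj σ' ⟨hf, hm, ho, hP, hPj, hS, hlen, hcnt, h14⟩
    have hG' : Fixed τ R σ' := hG.congr fun r hr => hf r (by omega)
    have h6 : σ'.reg 6 = σ.reg 6 := hf 6 (by norm_num)
    have h12' : σ'.reg 12 ≤ m := by omega
    -- The rest of the body gets whatever the counting leaves of the budget; the subtraction does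
    -- not truncate since `reg 12 ≤ m`.
    refine (Det.seq (t := 30 * m + 30 - 13 * σ'.reg 12)
      (det_countProg hG'.r1 (by rw [hG'.r4]; omega)) ?_).mono (by omega) fun _ => id
    rintro σ2 ⟨hf2, hm2, ho2, h19⟩
    have hG2 : Fixed τ R σ2 := hG'.congr fun r hr => hf2 r (by omega)
    rw [h6, h14, hG'.r4] at h19
    have e12 := hf2 12 (by norm_num)
    have e13 := hf2 13 (by norm_num)
    have e14 := hf2 14 (by norm_num)
    refine (Det.ite (t := 17 * σ'.reg 12 + 17) (fun h => ?_) (fun h => ?_)).mono (by omega)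
      fun _ => id
    · replace h : σ2.reg 19 < τ := by rw [← hG2.r2]; exact h
      refine (Det.block (by simp [Instr.IsDet]) ?_).mono (by simp) fun _ => id
      simp only [applyAll, St.set_reg, St.set_mem, St.set_out]
      simp only [Nat.reduceEqDiff, reduceIte, and_true, true_and]
      rw [e12, e13, e14, ho2, hm2, hG2.r1]
      refine ⟨⟨fun r hr => ?_, hm, ho, hP, by omega, hS, hlen, ?_⟩, h14, rfl⟩
      · rw [if_neg (by omega), if_neg (by omega), hf2 r (by omega), hf r hr]
      · intro y hy
        rcases lt_or_eq_of_le (Nat.le_of_lt_succ hy) with hy | rfl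
        · exact hcnt y hy
        · rw [← h19]; exact h
    · replace h : τ ≤ σ2.reg 19 := by rw [← hG2.r2]; exact not_lt.1 h
      refine (Det.seq (t := 7) (det_filterProg (by norm_num) (by norm_num) (by norm_num)
        hG2.r1 hG2.r5 (by rw [hG2.r4]; omega)) ?_).mono (by omega) fun _ => id
      rintro σ3 ⟨hf3, hm3, ho3, hrd3⟩
      have hG3 : Fixed τ R σ3 := hG2.congr fun r hr => hf3 r (by omega) (by omega)
      have g13 := hf3 13 (by norm_num) (by norm_num)
      have g14 := hf3 14 (by norm_num) (by norm_num)
      rw [hG2.r4] at hm3 hrd3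
      rw [hf2 6 (by norm_num), h6, e14, h14, hm2, e12] at hrd3
      have hlen3 : σ3.reg 12 + σ2.reg 19 = σ'.reg 12 := by
        have a1 := List.length_eq_countP_add_countP
          (fun x => decide (Cov d (σ.reg 6) j x)) (l := rd σ'.mem (2 * n) (σ'.reg 12))
        have a2 := congrArg List.length hrd3
        rw [rd_length, ← List.countP_eq_length_filter] at a2
        rw [rd_length, ← h19] at a1
        simp only [decide_eq_true_eq] at a1
        omega
      have u1 : (n + σ'.reg 13) % W = n + σ'.reg 13 := Nat.mod_eq_of_lt (by omega)
      have u2 : (σ'.reg 13 + 1) % W = σ'.reg 13 + 1 := Nat.mod_eq_of_lt (by omega)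
      refine Det.block (by simp [Instr.IsDet]) ?_
      simp only [applyAll, Instr.apply, Op.eval, St.set_reg, St.set_mem, St.set_out]
      simp only [Nat.reduceEqDiff, reduceIte, and_true, true_and]
      rw [hG3.r0, hG3.r1, g13, g14, e13, e14, h14, u1, u2, ho3, ho2]
      have hP' : rd (Function.update σ3.mem (n + σ'.reg 13) j) n (σ'.reg 13 + 1) =
          rd σ'.mem n (σ'.reg 13) ++ [j] := by
        rw [rd_succ, Function.update_self]
        congr 1
        refine rd_congr fun t ht => ?_
        rw [Function.update_of_ne (by omega), hm3 _ (by omega), hm2]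
      have hS' : rd (Function.update σ3.mem (n + σ'.reg 13) j) (2 * n) (σ3.reg 12) =
          rd σ3.mem (2 * n) (σ3.reg 12) :=
        rd_congr fun t ht => Function.update_of_ne (by omega) _ _
      rw [hP', hS', hrd3]
      refine ⟨⟨fun r hr => ?_, fun a ha => ?_, ho, ?_, by omega, ?_, ?_, ?_⟩, rfl, rfl⟩
      · rw [if_neg (by omega), if_neg (by omega), if_neg (by omega), if_neg (by omega),
          hf3 r (by omega) (by omega), hf2 r (by omega), hf r hr]
      · rw [Function.update_of_ne (by omega), hm3 _ (by omega), hm2, hm a ha]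
      · intro p hp
        rcases List.mem_append.1 hp with hp | hp
        · exact hP p hp
        · rw [List.mem_singleton.1 hp]; exact hj
      · rw [hS, filter_unc_append]
      · rw [Nat.add_mul]; omega
      · intro y hy
        rcases lt_or_eq_of_le (Nat.le_of_lt_succ hy) with hy | rfl
        -- Points examined earlier: the alive elements now form a sublist of the former ones.
        · exact (List.Sublist.countP_le List.filter_sublist).trans_lt (hcnt y hy)
        · rw [List.countP_filter, List.countP_eq_zero.2]
          · exact hτ
          · simp
  · rintro σ' ⟨hf, hm, ho, hP, hPj, hS, hlen, hcnt, h14⟩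
    exact ⟨hf, hm, ho, hP, hPj, hS, hlen, hcnt⟩

lemma apply_arith (σ : St n) (o : Op) (r a b : ℕ) :
    (Instr.arith o r a b).apply W σ = σ.set r (o.eval (σ.reg a) (σ.reg b) % W) := rfl

lemma apply_load (σ : St n) (r a : ℕ) :
    (Instr.load r a).apply W σ = σ.set r (σ.mem (σ.reg a)) := rfl

lemma emit_reg (σ : St n) (a b : ℕ) : ((Instr.emit a b).apply W σ).reg = σ.reg := rfl

lemma emit_mem (σ : St n) (a b : ℕ) : ((Instr.emit a b).apply W σ).mem = σ.mem := rfl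

/-- Stated through membership, the range test of `emit` disappears: no pair in `Fin n × Fin n`
matches registers out of range. -/
lemma mem_emit_out (σ : St n) (a b : ℕ) (e : Fin n × Fin n) :
    e ∈ ((Instr.emit a b).apply W σ).out ↔
      e ∈ σ.out ∨ ((e.1 : ℕ) = σ.reg a ∧ (e.2 : ℕ) = σ.reg b) := by
  obtain ⟨x, y⟩ := e
  simp only [Instr.apply]
  split_ifs with h
  · simp only [Finset.mem_insert, Prod.mk.injEq, Fin.ext_iff]
    tauto
  · have hx := x.2
    have hy := y.2
    refine ⟨Or.inl, fun h' => h'.resolve_right fun h2 => h ?_⟩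
    omega

/-- Outputs an edge from `reg 6` to every picked point, and removes the points that they cover from
the set of uncovered points. -/
def removeProg : Prog :=
  forLoop 14 13 (.seq (block [.arith .add 18 0 14, .load 15 18, .emit 6 15]) (filterProg 5 7 15))

open Classical in
-- The picks are stored from address n on and the uncovered points below n, so compacting the latter
-- leaves the former readable. Successive filtering amounts to filtering by the whole list of picks.
lemma det_removeProg {σ : St n} {τ R q : ℕ} (hG : Fixed τ R σ) (h13 : σ.reg 13 = q) (hq : q ≤ n)
    (h6 : σ.reg 6 < n) (h7 : σ.reg 7 ≤ n)
    (hP : ∀ p ∈ rd σ.mem n q, p < n) (hW : 2 * n < W) :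
    Det W d removeProg (q * (17 * n + 25) + 3) σ fun σ' =>
      (∀ r < 14, r ≠ 7 → σ'.reg r = σ.reg r) ∧
      rd σ'.mem 0 (σ'.reg 7) =
        (rd σ.mem 0 (σ.reg 7)).filter (fun x => Unc d (σ.reg 6) (rd σ.mem n q) x) ∧
      ∀ e, e ∈ σ'.out ↔ e ∈ σ.out ∨ ((e.1 : ℕ) = σ.reg 6 ∧ (e.2 : ℕ) ∈ rd σ.mem n q) := by
  refine (Det.forLoop (N := q) (by omega) (17 * n + 22) (fun j σ' =>
      (∀ r < 14, r ≠ 7 → σ'.reg r = σ.reg r) ∧ (∀ a ≥ n, σ'.mem a = σ.mem a) ∧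
      rd σ'.mem 0 (σ'.reg 7) =
        (rd σ.mem 0 (σ.reg 7)).filter (fun x => Unc d (σ.reg 6) (rd σ.mem n j) x) ∧
      (∀ e, e ∈ σ'.out ↔ e ∈ σ.out ∨ ((e.1 : ℕ) = σ.reg 6 ∧ (e.2 : ℕ) ∈ rd σ.mem n j)) ∧
      σ'.reg 14 = j)
    ?_ ?_ ?_).mono (Nat.add_le_add_right (Nat.mul_le_mul_left _ (by omega)) _) ?_
  · simp [St.set_reg, St.set_mem, St.set_out, Unc]
    intro r hr _ h
    omega
  · rintro j σ' ⟨hf, -, -, -, h14⟩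
    exact ⟨h14, (hf 13 (by norm_num) (by norm_num)).trans h13⟩
  · rintro j hj σ' ⟨hf, hm, hU, ho, h14⟩
    have hG' : Fixed τ R σ' := hG.congr fun r hr => hf r (by omega) (by omega)
    have e6 : σ'.reg 6 = σ.reg 6 := hf 6 (by norm_num) (by norm_num)
    have h7' : σ'.reg 7 ≤ n := by
      have := congrArg List.length hU
      rw [rd_length] at this
      have h2 := List.length_filter_le (fun x => decide (Unc d (σ.reg 6) (rd σ.mem n j) x))
        (rd σ.mem 0 (σ.reg 7))
      rw [rd_length] at h2
      omega
    have hp : σ.mem (n + j) < n :=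
      hP _ (List.mem_map.2 ⟨j, List.mem_range.2 hj, rfl⟩)
    have u1 : (n + j) % W = n + j := Nat.mod_eq_of_lt (by omega)
    have hmj : σ'.mem (n + j) = σ.mem (n + j) := hm _ (by omega)
    refine (Det.seq (s := 7) (t := 17 * n + 9) (Q := fun σ2 =>
      (∀ r < 15, σ2.reg r = σ'.reg r) ∧ σ2.reg 15 = σ.mem (n + j) ∧ σ2.mem = σ'.mem ∧
      ∀ e, e ∈ σ2.out ↔ e ∈ σ.out ∨ ((e.1 : ℕ) = σ.reg 6 ∧ (e.2 : ℕ) ∈ rd σ.mem n (j + 1)))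
      (Det.block (l := [.arith .add 18 0 14, .load 15 18, .emit 6 15]) (by simp [Instr.IsDet]) ?_)
      ?_).mono (by omega) fun _ => id
    · simp only [applyAll, St.set_out, mem_emit_out, St.set_reg, St.set_mem, emit_reg, emit_mem]
      simp only [apply_arith, apply_load, Op.eval, St.set_reg, St.set_mem, St.set_out]
      simp only [Nat.reduceEqDiff, reduceIte, and_true, true_and]
      rw [hG'.r0, h14, u1, hmj, e6]
      refine ⟨fun r hr => ?_, rfl, fun e => ?_⟩
      · rw [if_neg (by omega), if_neg (by omega), if_neg (by omega)]
      · rw [ho, rd_succ, List.mem_append, List.mem_singleton]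
        tauto
    · rintro σ2 ⟨hf2, h15, hm2, ho2⟩
      have hG2 : Fixed τ R σ2 := hG'.congr fun r hr => hf2 r (by omega)
      refine (det_filterProg (by norm_num) (by norm_num) (by norm_num) hG2.r1 hG2.r5 (by
        rw [hG2.r5, hf2 7 (by norm_num)]; omega)).mono (by rw [hf2 7 (by norm_num)]; omega) ?_
      rintro σ3 ⟨hf3, hm3, ho3, hrd3⟩
      rw [hG2.r5, hf2 7 (by norm_num)] at hm3 hrd3
      rw [hf2 6 (by norm_num), e6, h15, hm2, hU, ← filter_unc_append, ← rd_succ] at hrd3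
      refine ⟨⟨fun r hr h7r => ?_, fun a ha => ?_, ?_, ?_, ?_⟩, ?_, ?_⟩
      · rw [St.set_reg, if_neg (by omega), hf3 r (by omega) h7r, hf2 r (by omega), hf r hr h7r]
      · rw [St.set_mem, hm3 a (by omega), hm2, hm a ha]
      · simpa [St.set_reg, St.set_mem] using hrd3
      · rw [St.set_out, ho3]; exact ho2
      · simp [St.set_reg]
      · rw [hf3 14 (by norm_num) (by norm_num), hf2 14 (by norm_num), h14]
      · rw [hf3 1 (by norm_num) (by norm_num), hG2.r1]
  · rintro σ' ⟨hf, hm, hU, ho, h14⟩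
    exact ⟨hf, hU, ho⟩

/-- One round: samples uncovered points, covers most of the sample, and doubles the guess `reg 8` of
the optimum if that fails. -/
def roundProg : Prog :=
  .seq (block [.arith .mul 11 8 2, .arith .add 10 11 11, .arith .add 10 10 10])
    (.seq sampleProg (.seq (block [.arith .add 12 10 5, .const 13 0])
      (.seq passProg (.seq removeProg (.ite (.lt 12 11) (block []) (block [.arith .add 8 8 8]))))))

open Classical in
/-- The effect of a round with sample `S`. -/
def RoundPost (d : Fin n → Fin n → ℝ) (τ : ℕ) (σ σ' : St n) (S : List ℕ) : Prop :=
  (∀ r < 10, r ≠ 7 → r ≠ 8 → σ'.reg r = σ.reg r) ∧ S.length = 4 * (σ.reg 8 * τ) ∧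
  (∀ x ∈ S, x ∈ rd σ.mem 0 (σ.reg 7)) ∧ ∃ P : List ℕ, P.length ≤ 4 * σ.reg 8 ∧ (∀ p ∈ P, p < n) ∧
    rd σ'.mem 0 (σ'.reg 7) = (rd σ.mem 0 (σ.reg 7)).filter (fun x => Unc d (σ.reg 6) P x) ∧
    (∀ e, e ∈ σ'.out ↔ e ∈ σ.out ∨ ((e.1 : ℕ) = σ.reg 6 ∧ (e.2 : ℕ) ∈ P)) ∧
    ((σ'.reg 8 = σ.reg 8 ∧ (S.filter fun x => Unc d (σ.reg 6) P x).length < σ.reg 8 * τ) ∨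
      (σ'.reg 8 = 2 * σ.reg 8 ∧ σ.reg 8 * τ ≤ (S.filter fun x => Unc d (σ.reg 6) P x).length ∧
        ∀ y < n, (S.filter fun x => Unc d (σ.reg 6) P x).countP
          (fun x => Cov d (σ.reg 6) y x) < τ))

/-- The draws are the only random part, and everything after them is a sure consequence of the
sample. Hence the expected cost is an average over samples of any bound valid under `RoundPost`. -/
lemma runs_roundProg {σ : St n} {τ R k : ℕ} (hG : Fixed τ R σ) (hτ : 0 < τ) (h6 : σ.reg 6 < n)
    (h7 : σ.reg 7 ≤ n) (hu : 0 < σ.reg 7) (h8 : σ.reg 8 = k)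
    (hW : 2 * n + 4 * (k * τ) + 2 * k < W) (post : St n → ℝ≥0∞)
    (f : List ℕ → ℝ≥0∞) (hf : ∀ σ' S, RoundPost d τ σ σ' S → post σ' ≤ f S) :
    Runs W d roundProg (n * (120 * (k * τ) + 40) + 48 * (k * τ) + 4 * k * (17 * n + 25) + 40) σ post
      (sampleAvg (rd σ.mem 0 (σ.reg 7)) (4 * (k * τ)) f) := by
  classical
  have v1 : (k * τ) % W = k * τ := Nat.mod_eq_of_lt (by omega)
  have v2 : (k * τ + k * τ) % W = 2 * (k * τ) := by rw [Nat.mod_eq_of_lt (by omega)]; omega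
  have v3 : (2 * (k * τ) + 2 * (k * τ)) % W = 4 * (k * τ) := by
    rw [Nat.mod_eq_of_lt (by omega)]; omega
  have v4 : 4 * (k * τ) % W = 4 * (k * τ) := Nat.mod_eq_of_lt (by omega)
  refine (Det.seq_runs (s := 7) (t := n * (120 * (k * τ) + 40) + 48 * (k * τ) +
    4 * k * (17 * n + 25) + 25) (Q := fun σ1 => (∀ r < 10, σ1.reg r = σ.reg r) ∧
      σ1.reg 10 = 4 * (k * τ) ∧ σ1.reg 11 = k * τ ∧ σ1.mem = σ.mem ∧ σ1.out = σ.out)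
    (Det.block (l := [.arith .mul 11 8 2, .arith .add 10 11 11, .arith .add 10 10 10])
      (by simp [Instr.IsDet]) ?_) ?_).mono (by omega) (fun _ => le_rfl) le_rfl
  · simp only [applyAll, Instr.apply, Op.eval, St.set_reg, St.set_mem, St.set_out]
    simp only [Nat.reduceEqDiff, reduceIte, and_true, true_and]
    rw [hG.r2, h8, v1, v2, v3]
    refine ⟨fun r hr => ?_, rfl, rfl⟩
    rw [if_neg (by omega), if_neg (by omega), if_neg (by omega), if_neg (by omega)]
  rintro σ1 ⟨hf1, h10, h11, hm1, ho1⟩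
  have hG1 : Fixed τ R σ1 := hG.congr fun r hr => hf1 r (by omega)
  have hs := runs_sampleProg (W := W) (d := d) (σ := σ1) hG1.r1
    (by rw [hf1 7 (by norm_num)]; exact hu) (by rw [hf1 7 (by norm_num), hG1.r4]; omega)
    (by rw [hG1.r4, h10]; omega) (guarded (fun σ2 => (∀ r < 16, σ2.reg r = σ1.reg r) ∧
      (∀ a < 2 * n, σ2.mem a = σ.mem a) ∧ σ2.out = σ.out ∧
      (∀ x ∈ rd σ2.mem (2 * n) (4 * (k * τ)), x ∈ rd σ.mem 0 (σ.reg 7)))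
      fun σ2 => f (rd σ2.mem (2 * n) (4 * (k * τ)))) f (fun σ2 a1 a2 a3 a4 => by
        rw [hG1.r4, hm1] at a2
        rw [hG1.r4, h10, hm1, hf1 7 (by norm_num)] at a4
        rw [guarded_pos ⟨a1, a2, a3.trans ho1, a4⟩, hG1.r4, h10])
  rw [h10, hm1, hf1 7 (by norm_num)] at hs
  refine (Runs.seq (t := n * (120 * (k * τ) + 40) + 4 * k * (17 * n + 25) + 20) hs
    fun σ2 => ?_).mono (by omega) (fun _ => le_rfl) le_rfl
  by_cases h2 : (∀ r < 16, σ2.reg r = σ1.reg r) ∧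
      (∀ a < 2 * n, σ2.mem a = σ.mem a) ∧ σ2.out = σ.out ∧
      (∀ x ∈ rd σ2.mem (2 * n) (4 * (k * τ)), x ∈ rd σ.mem 0 (σ.reg 7))
  swap
  · rw [guarded, if_neg h2]; exact fun g rest T _ => le_top
  rw [guarded_pos h2]
  obtain ⟨hf2, hm2, ho2, hS2⟩ := h2
  have hG2 : Fixed τ R σ2 := hG1.congr fun r hr => hf2 r (by omega)
  refine Det.runs (Q := fun σ' => RoundPost d τ σ σ' (rd σ2.mem (2 * n) (4 * (k * τ)))) ?_
    fun σ' h => hf σ' _ h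
  refine (Det.seq (s := 5) (t := n * (120 * (k * τ) + 40) +
    4 * k * (17 * n + 25) + 14) (Q := fun σ3 => (∀ r < 12, σ3.reg r = σ2.reg r) ∧
      σ3.reg 12 = 4 * (k * τ) ∧ σ3.reg 13 = 0 ∧ σ3.mem = σ2.mem ∧ σ3.out = σ2.out)
    (Det.block (l := [.arith .add 12 10 5, .const 13 0]) (by simp [Instr.IsDet]) ?_) ?_).mono
      (by omega) fun _ => id
  · simp only [applyAll, Instr.apply, Op.eval, St.set_reg, St.set_mem, St.set_out]
    simp only [Nat.reduceEqDiff, reduceIte, and_true, true_and]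
    rw [hG2.r5, hf2 10 (by norm_num), h10, Nat.add_zero, v4, Nat.zero_mod]
    refine ⟨fun r hr => ?_, rfl, rfl⟩
    rw [if_neg (by omega), if_neg (by omega), if_neg (by omega)]
  rintro σ3 ⟨hf3, h12, h13, hm3, ho3⟩
  have hG3 : Fixed τ R σ3 := hG2.congr fun r hr => hf3 r (by omega)
  refine (Det.seq (t := 4 * k * (17 * n + 25) + 10)
    (det_passProg hG3 hτ h12 h13 (by omega)) ?_).mono
    (by rw [show 30 * (4 * (k * τ)) = 120 * (k * τ) by ring]; omega) fun _ => id
  rintro σ4 ⟨hf4, hm4, ho4, hP4, hPn, hS4, hlen, hcnt⟩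
  have hG4 : Fixed τ R σ4 := hG3.congr fun r hr => hf4 r (by omega)
  have eqr : ∀ r < 10, σ4.reg r = σ.reg r := fun r hr => by
    rw [hf4 r (by omega), hf3 r (by omega), hf2 r (by omega), hf1 r (by omega)]
  have e36 : σ3.reg 6 = σ.reg 6 := by
    rw [hf3 6 (by norm_num), hf2 6 (by norm_num), hf1 6 (by norm_num)]
  rw [e36] at hS4 hcnt
  -- Every pick used up τ of the 4kτ sample elements.
  have hPk : σ4.reg 13 ≤ 4 * k := by
    refine Nat.le_of_mul_le_mul_right (c := τ) ?_ hτ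
    rw [Nat.mul_assoc]; omega
  have hU4 : rd σ4.mem 0 (σ4.reg 7) = rd σ.mem 0 (σ.reg 7) := by
    rw [eqr 7 (by norm_num)]
    refine rd_congr fun t ht => ?_
    rw [hm4 _ (by omega), hm3, hm2 _ (by omega)]
  refine (Det.seq (t := 5) (det_removeProg hG4 rfl hPn (by rw [eqr 6 (by norm_num)]; exact h6)
    (by rw [eqr 7 (by norm_num)]; exact h7) hP4 (by omega)) ?_).mono
    (by have := Nat.mul_le_mul_right (17 * n + 25) hPk; omega) fun _ => id
  rintro σ5 ⟨hf5, hU5, ho5⟩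
  rw [hU4, eqr 6 (by norm_num)] at hU5
  rw [eqr 6 (by norm_num), ho4, ho3, ho2] at ho5
  have f12 := hf5 12 (by norm_num) (by norm_num)
  have f11 : σ5.reg 11 = k * τ := by
    rw [hf5 11 (by norm_num) (by norm_num), hf4 11 (by norm_num), hf3 11 (by norm_num),
      hf2 11 (by norm_num), h11]
  have f8 : σ5.reg 8 = k := by
    rw [hf5 8 (by norm_num) (by norm_num), eqr 8 (by norm_num), h8]
  have hl := congrArg List.length hS4
  rw [rd_length] at hl
  rw [hm3] at hS4 hl
  rw [hS4] at hcnt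
  refine (Det.ite (t := 3) (fun h => ?_) (fun h => ?_)).mono (by omega) fun _ => id
  · replace h : σ5.reg 12 < σ5.reg 11 := h
    refine (Det.block (by simp [Instr.IsDet]) ?_).mono (by simp) fun _ => id
    refine ⟨fun r hr h7r h8r => ?_, by simp [h8], hS2, rd σ4.mem n (σ4.reg 13),
      by simpa [h8] using hPk, hP4, ?_, ?_, Or.inl ⟨?_, ?_⟩⟩
    · simp only [applyAll, St.set_reg]
      rw [if_neg (by omega), hf5 r (by omega) h7r, eqr r hr]
    · simpa [applyAll, St.set_reg, St.set_mem] using hU5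
    · simpa [applyAll, St.set_out] using ho5
    · simp [applyAll, St.set_reg, f8, h8]
    · rw [← hl, h8, ← f11, ← f12]; exact h
  · replace h : ¬ σ5.reg 12 < σ5.reg 11 := h
    refine (Det.block (by simp [Instr.IsDet]) ?_).mono (by simp) fun _ => id
    refine ⟨fun r hr h7r h8r => ?_, by simp [h8], hS2, rd σ4.mem n (σ4.reg 13),
      by simpa [h8] using hPk, hP4, ?_, ?_, Or.inr ⟨?_, ?_, hcnt⟩⟩
    · simp only [applyAll, Instr.apply, St.set_reg]
      rw [if_neg (by omega), if_neg (by omega), hf5 r (by omega) h7r, eqr r hr]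
    · simpa [applyAll, Instr.apply, St.set_reg, St.set_mem] using hU5
    · simpa [applyAll, Instr.apply, St.set_out] using ho5
    · simp [applyAll, Instr.apply, Op.eval, St.set_reg, f8, h8]
      rw [Nat.mod_eq_of_lt (by omega)]; omega
    · rw [← hl, h8, ← f11, ← f12]; exact not_lt.1 h

end

/-! ### Concentration of the sample and the union bound -/

section
variable {n : ℕ} {d : Fin n → Fin n → ℝ}

lemma sampleAvg_add (U : List ℕ) (m : ℕ) (f g : List ℕ → ℝ≥0∞) :
    sampleAvg U m (fun l => f l + g l) = sampleAvg U m f + sampleAvg U m g := by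
  induction m generalizing f g with
  | zero => rfl
  | succ m ih =>
    simp only [sampleAvg]
    simp_rw [ih]
    rw [List.sum_map_add, ENNReal.add_div]

/-- Independence of the draws: the expectation of a product is the product of the expectations. -/
lemma sampleAvg_prod (U : List ℕ) (m : ℕ) (c : ℝ≥0∞) (w : ℕ → ℝ≥0∞) :
    sampleAvg U m (fun l => c * (l.map w).prod) = c * ((U.map w).sum / (U.length : ℕ)) ^ m := by
  induction m generalizing c with
  | zero => simp [sampleAvg]
  | succ m ih =>
    simp only [sampleAvg, List.map_cons, List.prod_cons]
    simp_rw [← mul_assoc, ih]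
    rw [List.sum_map_mul_right, List.sum_map_mul_left, pow_succ]
    simp only [div_eq_mul_inv]
    ring

lemma sampleAvg_const {U : List ℕ} (hU : U ≠ []) (m : ℕ) (c : ℝ≥0∞) :
    sampleAvg U m (fun _ => c) = c := by
  have := sampleAvg_prod U m c (fun _ => 1)
  have hl : (U.length : ℝ≥0∞) ≠ 0 := by simpa using hU
  simpa [ENNReal.div_self hl] using this

lemma sampleAvg_sum {ι : Type*} (s : Finset ι) {U : List ℕ} (hU : U ≠ []) (m : ℕ)
    (f : ι → List ℕ → ℝ≥0∞) :
    sampleAvg U m (fun l => ∑ i ∈ s, f i l) = ∑ i ∈ s, sampleAvg U m (f i) := by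
  classical
  induction s using Finset.induction_on with
  | empty => simpa using sampleAvg_const hU m 0
  | insert a s ha ih =>
    simp_rw [Finset.sum_insert ha]
    rw [sampleAvg_add, ih]

open Classical in
/-- The weight `1 / 4` on the points with a property `q`, and `1` on the others. -/
noncomputable def quarter (q : ℕ → Prop) (x : ℕ) : ℝ≥0∞ := if q x then 4⁻¹ else 1

open Classical in
-- With more than half of the elements in `q`, the mean weight is at most 1/2 · 1/4 + 1/2 · 1 = 5/8.
lemma sum_quarter_le {q : ℕ → Prop} {U : List ℕ}
    (h : U.length < 2 * (U.filter fun x => q x).length) :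
    (U.map (quarter q)).sum / (U.length : ℕ) ≤ 5 / 8 := by
  -- An element of `q` contributes 1 + 3 and any other element 4; the additive form avoids
  -- subtraction in `ℝ≥0∞`.
  have key : ∀ l : List ℕ, 4 * (l.map (quarter q)).sum + 3 * ((l.filter fun x => q x).length : ℕ) =
      4 * (l.length : ℕ) := by
    intro l
    induction l with
    | nil => simp
    | cons x l ih =>
      have h4 : (4 : ℝ≥0∞) * 4⁻¹ = 1 := ENNReal.mul_inv_cancel (by norm_num) (by norm_num)
      by_cases hx : q x
      · simp only [List.map_cons, List.sum_cons, quarter, hx, if_true, List.filter_cons,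
          decide_true, List.length_cons, Nat.cast_add, Nat.cast_one] at ih ⊢
        rw [mul_add, h4, mul_add, mul_add, ← ih]
        ring_nf
      · simp only [List.map_cons, List.sum_cons, quarter, hx, if_false, List.filter_cons,
          decide_false, List.length_cons, Nat.cast_add, Nat.cast_one] at ih ⊢
        rw [mul_add, mul_add, ← ih]
        simp only [Bool.false_eq_true, if_false]
        ring
  have hl : (U.length : ℝ≥0∞) ≠ 0 := by
    intro h0
    have : U.length = 0 := by exact_mod_cast h0
    have h2 := List.length_filter_le (fun x => decide (q x)) U
    omega
  have h8 : 8 * (U.map (quarter q)).sum ≤ 5 * (U.length : ℝ≥0∞) := by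
    have h1 : (3 * U.length : ℝ≥0∞) ≤ 3 * (2 * ((U.filter fun x => q x).length : ℕ)) := by
      gcongr
      exact_mod_cast h.le
    have h2 : 8 * (U.map (quarter q)).sum + 3 * (2 * ((U.filter fun x => q x).length : ℕ)) =
        5 * (U.length : ℝ≥0∞) + 3 * U.length := by
      have := congrArg (fun z => 2 * z) (key U)
      calc _ = 2 * (4 * (U.map (quarter q)).sum + 3 * ((U.filter fun x => q x).length : ℕ)) := by ring
        _ = _ := by rw [this]; ring
    refine ENNReal.le_of_add_le_add_right (a := 3 * (U.length : ℝ≥0∞))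
      (ENNReal.mul_ne_top (by norm_num) (by simp)) ?_
    rw [← h2]
    gcongr
  rw [ENNReal.div_le_iff hl (by simp)]
  calc (U.map (quarter q)).sum = 8⁻¹ * (8 * (U.map (quarter q)).sum) := by
        rw [← mul_assoc, ENNReal.inv_mul_cancel (by norm_num) (by norm_num), one_mul]
    _ ≤ 8⁻¹ * (5 * (U.length : ℝ≥0∞)) := by gcongr
    _ = _ := by rw [div_eq_mul_inv]; ring

open Classical in
-- The Markov step of an exponential-moment bound: the product is 4 to the power minus the number of
-- sample elements in `q`.
lemma one_le_quarter_prod {q : ℕ → Prop} {S : List ℕ} {t : ℕ}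
    (h : (S.filter fun x => q x).length ≤ t) : 1 ≤ 4 ^ t * (S.map (quarter q)).prod := by
  have key : ∀ l : List ℕ, (l.map (quarter q)).prod = 4⁻¹ ^ (l.filter fun x => q x).length := by
    intro l
    induction l with
    | nil => simp
    | cons x l ih =>
      by_cases hx : q x
      · simp [quarter, hx, pow_succ, mul_comm] at ih ⊢
        rw [ih, mul_comm]
      · simp [quarter, hx] at ih ⊢
        rw [ih]
  rw [key, ← ENNReal.inv_pow, ← div_eq_mul_inv,
    ENNReal.le_div_iff_mul_le (Or.inl (by simp)) (Or.inl (by simp)), one_mul]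
  exact pow_le_pow_right₀ (by norm_num) h

/-- The tuple of points coded by `F`, where the code `n` stands for no point. -/
def codeList {k : ℕ} (F : Fin k → Fin (n + 1)) : List ℕ := List.ofFn fun j => (F j : ℕ)

/-- Shorter lists are padded with n, which names no point and therefore covers nothing. So the union
bound may range over tuples of one fixed length. -/
lemma exists_codeList (d : Fin n → Fin n → ℝ) (i : ℕ) {k : ℕ} {P : List ℕ} (hk : P.length ≤ k)
    (hP : ∀ p ∈ P, p < n) : ∃ F : Fin k → Fin (n + 1), Unc d i (codeList F) = Unc d i P := by
  have hlt : ∀ j, P.getD j n < n + 1 := by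
    intro j
    by_cases hj : j < P.length
    · rw [List.getD_eq_getElem _ _ hj]
      exact (hP _ (List.getElem_mem hj)).trans (Nat.lt_succ_self n)
    · rw [List.getD_eq_default _ _ (not_lt.1 hj)]
      exact Nat.lt_succ_self n
  refine ⟨fun j => ⟨P.getD j n, hlt j⟩, ?_⟩
  funext x
  refine propext ⟨fun h p hp => ?_, fun h p hp => ?_⟩
  · obtain ⟨j, hj, rfl⟩ := List.getElem_of_mem hp
    refine h _ ?_
    rw [codeList, List.mem_ofFn]
    exact ⟨⟨j, by omega⟩, List.getD_eq_getElem _ _ hj⟩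
  · rw [codeList, List.mem_ofFn] at hp
    obtain ⟨j, rfl⟩ := hp
    by_cases hj : (j : ℕ) < P.length
    · simp only [List.getD_eq_getElem _ _ hj]
      exact h _ (List.getElem_mem hj)
    · simp only [List.getD_eq_default _ _ (not_lt.1 hj)]
      rintro ⟨-, hy, -⟩
      exact lt_irrefl _ hy

open Classical in
/-- An upper bound for the indicator of the event that points that cover most of the sample `S` leave
more than half of `U` uncovered. -/
noncomputable def badSum (d : Fin n → Fin n → ℝ) (i k t : ℕ) (U S : List ℕ) : ℝ≥0∞ :=
  ∑ F : Fin (4 * k) → Fin (n + 1),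
    (if U.length < 2 * (U.filter fun x => Unc d i (codeList F) x).length then 4 ^ t else 0) *
      (S.map (quarter (Unc d i (codeList F)))).prod

open Classical in
-- The picks depend on the sample, but they occur among the tuples summed over, and their term alone
-- is at least 1.
lemma one_le_badSum {i k t : ℕ} {U S P : List ℕ} (hk : P.length ≤ 4 * k) (hP : ∀ p ∈ P, p < n)
    (hU : U.length < 2 * (U.filter fun x => Unc d i P x).length)
    (hS : (S.filter fun x => Unc d i P x).length ≤ t) : 1 ≤ badSum d i k t U S := by
  obtain ⟨F, hF⟩ := exists_codeList d i hk hP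
  refine le_trans ?_ (Finset.single_le_sum (fun _ _ => bot_le) (Finset.mem_univ F))
  rw [hF, if_pos hU]
  exact one_le_quarter_prod hS

lemma sampleAvg_badSum_le {i k t : ℕ} {U : List ℕ} (hU : U ≠ []) :
    sampleAvg U (4 * t) (badSum d i k t U) ≤
      (n + 1 : ℕ) ^ (4 * k) * (4 ^ t * (5 / 8) ^ (4 * t)) := by
  classical
  unfold badSum
  rw [sampleAvg_sum _ hU]
  refine (Finset.sum_le_card_nsmul _ _ (4 ^ t * (5 / 8) ^ (4 * t)) fun F _ => ?_).trans ?_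
  · rw [sampleAvg_prod U]
    split_ifs with h
    · exact mul_le_mul_right (pow_le_pow_left₀ bot_le (sum_quarter_le h) _) _
    · simp
  · simp

/-- Since (4 · (5/8)⁴)² ≤ 1/2, the factor 28 in τ gives 2^(-14Lk) ≤ n^(-14k). The number of tuples
is at most n^(8k) because n + 1 ≤ n², which leaves n^(-6k). -/
lemma failure_bound {n k L : ℕ} (hn : 2 ≤ n) (hk : 1 ≤ k) (hL : n ≤ 2 ^ L) :
    ((n + 1 : ℕ) : ℝ≥0∞) ^ (4 * k) * (4 ^ (k * (28 * L)) * (5 / 8) ^ (4 * (k * (28 * L)))) ≤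
      ((n : ℝ≥0∞) ^ 6)⁻¹ := by
  have hn0 : (0 : ℝ) < n := by positivity
  have hreal : ((n + 1 : ℕ) : ℝ) ^ (4 * k) * (4 ^ (k * (28 * L)) * (5 / 8) ^ (4 * (k * (28 * L)))) ≤
      ((n : ℝ) ^ 6)⁻¹ := by
    have h1 : ((n + 1 : ℕ) : ℝ) ^ (4 * k) ≤ (n : ℝ) ^ (8 * k) := by
      have : ((n + 1 : ℕ) : ℝ) ≤ (n : ℝ) ^ 2 := by
        have : n + 1 ≤ n ^ 2 := by nlinarith
        exact_mod_cast this
      calc ((n + 1 : ℕ) : ℝ) ^ (4 * k) ≤ ((n : ℝ) ^ 2) ^ (4 * k) := by gcongr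
        _ = _ := by rw [← pow_mul]; congr 1; ring
    have h2 : (4 : ℝ) ^ (k * (28 * L)) * (5 / 8) ^ (4 * (k * (28 * L))) ≤
        ((n : ℝ) ^ (14 * k))⁻¹ := by
      calc (4 : ℝ) ^ (k * (28 * L)) * (5 / 8) ^ (4 * (k * (28 * L)))
          = ((4 * (5 / 8) ^ 4) ^ 2) ^ (L * (14 * k)) := by
            rw [mul_pow, mul_pow, ← pow_mul, ← pow_mul, ← pow_mul]
            rw [show 2 * (L * (14 * k)) = k * (28 * L) by ring]
        _ ≤ (1 / 2) ^ (L * (14 * k)) := by gcongr; norm_num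
        _ = (((2 : ℝ) ^ L) ^ (14 * k))⁻¹ := by rw [one_div, inv_pow, pow_mul]
        _ ≤ ((n : ℝ) ^ (14 * k))⁻¹ := by
            gcongr
            exact_mod_cast hL
    calc _ ≤ (n : ℝ) ^ (8 * k) * ((n : ℝ) ^ (14 * k))⁻¹ := by gcongr
      _ = ((n : ℝ) ^ (6 * k))⁻¹ := by
        rw [show 14 * k = 8 * k + 6 * k by ring, pow_add, mul_inv, ← mul_assoc,
          mul_inv_cancel₀ (by positivity), one_mul]
      _ ≤ _ := by
        gcongr
        · exact_mod_cast (by omega : 1 ≤ n)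
        · omega
  have := ENNReal.ofReal_le_ofReal hreal
  rw [ENNReal.ofReal_mul (by positivity), ENNReal.ofReal_mul (by positivity),
    ENNReal.ofReal_pow (by positivity), ENNReal.ofReal_pow (by positivity),
    ENNReal.ofReal_pow (by positivity), ENNReal.ofReal_inv_of_pos (by positivity),
    ENNReal.ofReal_pow (by positivity), ENNReal.ofReal_natCast, ENNReal.ofReal_natCast,
    ENNReal.ofReal_div_of_pos (by norm_num)] at this
  simpa using this

/-! ### The optima OPT_i and OPT* -/

lemma exists_isCover (hd : IsDistance d) (i : Fin n) :
    ∃ N : Finset (Fin n), IsCover d i N ∧ N.card = optAt d i := by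
  refine Nat.sInf_mem (s := {m | ∃ N : Finset (Fin n), IsCover d i N ∧ N.card = m})
    ⟨_, Finset.univ.erase i, ⟨by simp, fun j hj => ⟨j, by simp [hj], hj, ?_⟩⟩, rfl⟩
  rw [hd.self]
  exact hd.pos j i hj

lemma optAt_pos (hd : IsDistance d) (hn : 2 ≤ n) (i : Fin n) : 1 ≤ optAt d i := by
  obtain ⟨N, hN, hc⟩ := exists_isCover hd i
  rw [← hc, Nat.one_le_iff_ne_zero, Finset.card_ne_zero]
  have : Nontrivial (Fin n) := Fin.nontrivial_iff_two_le.2 hn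
  obtain ⟨j, hj⟩ := exists_ne i
  obtain ⟨k, hk, -⟩ := hN.2 j hj
  exact ⟨k, hk⟩

lemma optAt_le (hd : IsDistance d) (i : Fin n) : optAt d i ≤ n := by
  obtain ⟨N, hN, hc⟩ := exists_isCover hd i
  rw [← hc]
  simpa using N.card_le_univ

open Classical in
-- Pigeonhole: an optimal cover covers all of S with at most τ - 1 elements per set, so |S| ≤ OPT_i
-- · (τ - 1). This is less than kτ if OPT_i ≤ k. It certifies that the guess was too small.
lemma lt_optAt (hd : IsDistance d) (i : Fin n) {k τ : ℕ} (hk : 0 < k) {S : List ℕ}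
    (hS : ∀ x ∈ S, x < n ∧ x ≠ i) (hkS : k * τ ≤ S.length)
    (hc : ∀ y < n, S.countP (fun x => Cov d i y x) < τ) : k < optAt d i := by
  obtain ⟨N, hN, hcard⟩ := exists_isCover hd i
  have key : ∀ l : List ℕ, (∀ x ∈ l, x < n ∧ x ≠ i) →
      l.length ≤ ∑ y ∈ N, l.countP (fun x => Cov d i y x) := by
    intro l
    induction l with
    | nil => simp
    | cons x l ih =>
      intro hl
      have h1 := ih fun x hx => hl x (List.mem_cons_of_mem _ hx)
      obtain ⟨hxn, hxi⟩ := hl x List.mem_cons_self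
      obtain ⟨y, hy, -, hlt⟩ := hN.2 ⟨x, hxn⟩ (fun h => hxi (congrArg Fin.val h))
      have hcov : Cov d i y x := ⟨i.2, y.2, hxn, hlt⟩
      simp_rw [List.countP_cons]
      rw [Finset.sum_add_distrib, List.length_cons]
      have : 1 ≤ ∑ z ∈ N, if (decide (Cov d i z x)) = true then 1 else 0 := by
        refine le_trans ?_ (Finset.single_le_sum (fun _ _ => Nat.zero_le _) hy)
        simp [hcov]
      omega
  have h1 := key S hS
  have h2 : ∑ y ∈ N, S.countP (fun x => Cov d i y x) ≤ N.card * (τ - 1) := by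
    rw [← smul_eq_mul]
    exact Finset.sum_le_card_nsmul _ _ _ fun y _ => Nat.le_sub_one_of_lt (hc y y.2)
  by_contra hlt
  rw [hcard] at h2
  have h3 : optAt d i * (τ - 1) ≤ k * (τ - 1) := Nat.mul_le_mul_right _ (not_lt.1 hlt)
  have hτ : 0 < τ := (Nat.zero_le _).trans_lt (hc i i.2)
  have h4 : k * (τ - 1) < k * τ := Nat.mul_lt_mul_of_pos_left (by omega) hk
  omega

lemma exists_navigable (hd : IsDistance d) :
    ∃ E : Finset (Fin n × Fin n), Navigable d E ∧ E.card = optEdges d := by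
  refine Nat.sInf_mem (s := {m | ∃ E : Finset (Fin n × Fin n), Navigable d E ∧ E.card = m})
    ⟨_, Finset.univ, fun i j hij => ⟨j, by simp, ?_⟩, rfl⟩
  rw [hd.self]
  exact hd.pos i j hij

lemma sum_card_outNbrs (E : Finset (Fin n × Fin n)) : ∑ i, (outNbrs E i).card = E.card := by
  rw [Finset.card_eq_sum_card_fiberwise (f := Prod.fst) (t := Finset.univ) (by simp)]
  refine Finset.sum_congr rfl fun i _ => ?_
  refine Finset.card_bij (fun k _ => (i, k)) ?_ ?_ ?_
  · intro k hk
    simpa [outNbrs] using hk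
  · intro a _ b _ h
    simpa using h
  · rintro ⟨a, b⟩ h
    simp only [Finset.mem_filter] at h
    obtain ⟨h1, rfl⟩ := h
    exact ⟨b, by simpa [outNbrs] using h1, rfl⟩

lemma sum_optAt_le (hd : IsDistance d) : ∑ i, optAt d i ≤ optEdges d := by
  obtain ⟨E, hE, hc⟩ := exists_navigable hd
  rw [← hc, ← sum_card_outNbrs]
  refine Finset.sum_le_sum fun i _ => ?_
  -- A navigable graph may contain loops, but a cover of the instance of i may not contain i.
  have : IsCover d i ((outNbrs E i).erase i) := by
    refine ⟨by simp, fun j hj => ?_⟩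
    obtain ⟨k, hk, hlt⟩ := hE i j (Ne.symm hj)
    refine ⟨k, ?_, hj, by rwa [hd.symm j k, hd.symm j i]⟩
    rw [Finset.mem_erase]
    refine ⟨?_, by simpa [outNbrs] using hk⟩
    rintro rfl
    exact lt_irrefl _ hlt
  have hle : optAt d i ≤ ((outNbrs E i).erase i).card := Nat.sInf_le ⟨_, this, rfl⟩
  exact hle.trans (Finset.card_le_card (Finset.erase_subset _ _))

end

/-! ### Invariants of the rounds and of the loop over the points -/

section
variable {n : ℕ} {W : ℕ} {d : Fin n → Fin n → ℝ}

/-- The edges of `E` solve the navigation problem at all points before `i`. -/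
def NavBelow (d : Fin n → Fin n → ℝ) (i : ℕ) (E : Finset (Fin n × Fin n)) : Prop :=
  ∀ j : Fin n, (j : ℕ) < i → ∀ x, j ≠ x → ∃ k, (j, k) ∈ E ∧ d k x < d j x

lemma NavBelow.mono {i : ℕ} {E E' : Finset (Fin n × Fin n)} (h : NavBelow d i E) (hE : E ⊆ E') :
    NavBelow d i E' := fun j hj x hx => by
  obtain ⟨k, hk, hlt⟩ := h j hj x hx
  exact ⟨k, hE hk, hlt⟩

/-- What surely holds after `r` rounds for the point `i`. -/
structure RoundInv (d : Fin n → Fin n → ℝ) (τ R : ℕ) (i : Fin n) (r : ℕ) (σ : St n) : Prop where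
  fixed : Fixed τ R σ
  r6 : σ.reg 6 = i
  r9 : σ.reg 9 = r
  u_le : σ.reg 7 ≤ n
  mem_U : ∀ x ∈ rd σ.mem 0 (σ.reg 7), x < n ∧ x ≠ i
  k_pos : 1 ≤ σ.reg 8
  k_le : σ.reg 8 ≤ 2 * optAt d i
  covered : ∀ x < n, x ≠ i → x ∈ rd σ.mem 0 (σ.reg 7) ∨ ∃ p, (i, p) ∈ σ.out ∧ Cov d i p x
  deg : (outNbrs σ.out i).card ≤ r * (8 * optAt d i)
  prev : ∀ j : Fin n, j < i → (outNbrs σ.out j).card ≤ R * (8 * optAt d j)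
  next : ∀ e ∈ σ.out, e.1 ≤ i

/-- The number of uncovered points is as small as expected after `r` rounds for the point `i`, and
the earlier points are done. -/
def RoundOk (d : Fin n → Fin n → ℝ) (i r : ℕ) (σ : St n) : Prop :=
  NavBelow d i σ.out ∧ σ.reg 7 * 2 ^ r ≤ n * σ.reg 8

open Classical in
/-- The indicator of the failure of `p`. -/
noncomputable def failInd (p : Prop) : ℝ≥0∞ := if p then 0 else 1

lemma failInd_mono {p q : Prop} (h : p → q) : failInd q ≤ failInd p := by
  unfold failInd
  split_ifs <;> simp_all

lemma failInd_le_one (p : Prop) : failInd p ≤ 1 := by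
  unfold failInd
  split_ifs <;> simp

lemma card_filter_mem_le (P : List ℕ) :
    (Finset.univ.filter fun k : Fin n => (k : ℕ) ∈ P).card ≤ P.length := by
  classical
  refine le_trans ?_ P.toFinset_card_le
  refine Finset.card_le_card_of_injOn Fin.val (fun k hk => ?_) (Fin.val_injective.injOn)
  simpa using hk

lemma RoundInv.step (hd : IsDistance d) {τ R r : ℕ} {i : Fin n} {σ σ' : St n} {S : List ℕ}
    (h : RoundInv d τ R i r σ) (hp : RoundPost d τ σ σ' S) :
    RoundInv d τ R i (r + 1) (σ'.set 9 (r + 1)) ∧ σ'.reg 9 = r ∧ σ'.reg 1 = 1 := by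
  classical
  obtain ⟨hf, hSl, hSU, P, hPl, hPn, hU, ho, hk⟩ := hp
  have hG' : Fixed τ R σ' := h.fixed.congr fun q hq => hf q (by omega) (by omega) (by omega)
  rw [h.r6] at hU ho hk
  have hU' : ∀ x ∈ rd σ'.mem 0 (σ'.reg 7), x ∈ rd σ.mem 0 (σ.reg 7) := fun x hx => by
    rw [hU] at hx; exact (List.mem_filter.1 hx).1
  refine ⟨⟨?_, ?_, ?_, ?_, ?_, ?_, ?_, ?_, ?_, ?_, ?_⟩, ?_, hG'.r1⟩
  · exact hG'.congr fun q hq => by rw [St.set_reg, if_neg (by omega)]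
  · simp only [St.set_reg, Nat.reduceEqDiff, reduceIte]
    rw [hf 6 (by norm_num) (by norm_num) (by norm_num), h.r6]
  · simp [St.set_reg]
  · simp only [St.set_reg, Nat.reduceEqDiff, reduceIte]
    have h1 := congrArg List.length hU
    have h2 := List.length_filter_le (fun x => decide (Unc d i P x)) (rd σ.mem 0 (σ.reg 7))
    rw [rd_length] at h1 h2
    have := h.u_le
    omega
  · simp only [St.set_reg, St.set_mem, Nat.reduceEqDiff, reduceIte]
    exact fun x hx => h.mem_U x (hU' x hx)
  · simp only [St.set_reg, Nat.reduceEqDiff, reduceIte]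
    have := h.k_pos
    omega
  · simp only [St.set_reg, Nat.reduceEqDiff, reduceIte]
    rcases hk with ⟨hk, -⟩ | ⟨hk, hlen, hcnt⟩
    · rw [hk]; exact h.k_le
    -- The guess is doubled only when it is below `optAt d i`, so it remains at most twice that
    -- number.
    · have := lt_optAt hd i h.k_pos (fun x hx => h.mem_U x (hSU x (List.mem_filter.1 hx).1)) hlen hcnt
      omega
  · simp only [St.set_reg, St.set_mem, St.set_out, Nat.reduceEqDiff, reduceIte]
    intro x hx hxi
    rcases h.covered x hx hxi with hxU | ⟨p, hp, hc⟩
    · by_cases hxP : Unc d i P x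
      · left; rw [hU]; exact List.mem_filter.2 ⟨hxU, by simpa using hxP⟩
      · right
        simp only [Unc, not_forall, not_not] at hxP
        obtain ⟨p, hp, hc⟩ := hxP
        exact ⟨⟨p, hPn p hp⟩, (ho _).2 (Or.inr ⟨rfl, hp⟩), hc⟩
    · exact Or.inr ⟨p, (ho _).2 (Or.inl hp), hc⟩
  · rw [St.set_out]
    have hsub : outNbrs σ'.out i ⊆ outNbrs σ.out i ∪
        (Finset.univ.filter fun k : Fin n => (k : ℕ) ∈ P) := by
      intro k hk
      simp only [outNbrs, Finset.mem_union, Finset.mem_filter, Finset.mem_univ, true_and] at hk ⊢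
      rcases (ho _).1 hk with hk | ⟨-, hk⟩
      · exact Or.inl hk
      · exact Or.inr hk
    have h1 := (Finset.card_le_card hsub).trans (Finset.card_union_le _ _)
    have h2 := card_filter_mem_le (n := n) P
    have h3 := h.deg
    have h4 := h.k_le
    rw [Nat.succ_mul]
    omega
  · intro j hj
    rw [St.set_out]
    refine le_trans (Finset.card_le_card fun k hk => ?_) (h.prev j hj)
    simp only [outNbrs, Finset.mem_filter, Finset.mem_univ, true_and] at hk ⊢
    rcases (ho _).1 hk with hk | ⟨hk, -⟩
    · exact hk
    · exact absurd hk (ne_of_lt hj)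
  · intro e he
    rcases (ho _).1 he with he | ⟨he, -⟩
    · exact h.next e he
    · exact le_of_eq (Fin.ext he)
  · rw [hf 9 (by norm_num) (by norm_num) (by norm_num), h.r9]

/-- If k doubles, the right side of |U| · 2^r ≤ n · k doubles with the left factor 2^r, and |U| does
not grow. If k stays, the inequality can only break when more than half of U survives although the
sample is mostly covered, and then `badSum` is at least 1. -/
lemma failInd_roundOk_le {τ R r : ℕ} {i : Fin n} {σ σ' : St n} {S : List ℕ}
    (h : RoundInv d τ R i r σ) (hp : RoundPost d τ σ σ' S) :
    failInd (RoundOk d i (r + 1) (σ'.set 9 (r + 1))) ≤ failInd (RoundOk d i r σ) +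
      badSum d i (σ.reg 8) (σ.reg 8 * τ) (rd σ.mem 0 (σ.reg 7)) S := by
  classical
  obtain ⟨hf, hSl, hSU, P, hPl, hPn, hU, ho, hk⟩ := hp
  rw [h.r6] at hU ho hk
  by_cases h0 : RoundOk d i r σ
  · by_cases h1 : RoundOk d i (r + 1) (σ'.set 9 (r + 1))
    · rw [failInd, if_pos h1]; exact bot_le
    refine (failInd_le_one _).trans (le_trans ?_ le_add_self)
    have hnav : NavBelow d i σ'.out := h0.1.mono fun e he => (ho e).2 (Or.inl he)
    have h2 : n * σ'.reg 8 < σ'.reg 7 * 2 ^ (r + 1) := by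
      by_contra hc
      refine h1 ⟨hnav, ?_⟩
      simpa [St.set_reg] using hc
    have h0' := h0.2
    have hlen := congrArg List.length hU
    have hle := List.length_filter_le (fun x => decide (Unc d i P x)) (rd σ.mem 0 (σ.reg 7))
    rw [rd_length] at hlen hle
    rcases hk with ⟨hk, hlt⟩ | ⟨hk, -, -⟩
    · refine one_le_badSum hPl hPn ?_ hlt.le
      rw [← hU, rd_length, rd_length]
      rw [hk] at h2
      by_contra hc
      have h3 : σ'.reg 7 * 2 ^ (r + 1) = 2 * σ'.reg 7 * 2 ^ r := by ring
      have h4 := Nat.mul_le_mul_right (2 ^ r) (not_lt.1 hc)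
      omega
    · exfalso
      rw [← hlen] at hle
      rw [hk] at h2
      have h3 : σ'.reg 7 * 2 ^ (r + 1) = 2 * (σ'.reg 7 * 2 ^ r) := by ring
      have h4 := Nat.mul_le_mul_right (2 ^ r) hle
      have h5 : n * (2 * σ.reg 8) = 2 * (n * σ.reg 8) := by ring
      omega
  · refine (failInd_le_one _).trans (le_trans ?_ le_self_add)
    rw [failInd, if_neg h0]

/-- The time for a round for a point with set cover optimum `o`. -/
def roundTime (n τ o : ℕ) : ℕ :=
  n * (240 * (o * τ) + 40) + 96 * (o * τ) + 8 * o * (17 * n + 25) + 41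

/-- The potential is the failure indicator plus ε for each remaining round; the ε released by this
round pays for its expected `badSum`. The constant c carries the allowance for later points. -/
lemma runs_round (hd : IsDistance d) {τ R r L : ℕ} {i : Fin n} {σ : St n} {ε c : ℝ≥0∞}
    (hτ : 0 < τ) (hτL : τ = 28 * L) (hn : 2 ≤ n) (hL : n ≤ 2 ^ L) (hε : ε = ((n : ℝ≥0∞) ^ 6)⁻¹)
    (hW : 6 * n + 8 * (n * τ) < W) (hr : r < R) (h : RoundInv d τ R i r σ) :
    Runs W d (.ite (.lt 5 7) roundProg (block [])) (roundTime n τ (optAt d i)) σ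
      (guarded (fun σ' => RoundInv d τ R i (r + 1) (σ'.set 9 (r + 1)) ∧ σ'.reg 9 = r ∧ σ'.reg 1 = 1)
        fun σ' => failInd (RoundOk d i (r + 1) (σ'.set 9 (r + 1))) +
          (((R - (r + 1) : ℕ) : ℝ≥0∞) * ε + c))
      (failInd (RoundOk d i r σ) + (((R - r : ℕ) : ℝ≥0∞) * ε + c)) := by
  have hRr : ((R - r : ℕ) : ℝ≥0∞) * ε = ε + ((R - (r + 1) : ℕ) : ℝ≥0∞) * ε := by
    rw [show R - r = R - (r + 1) + 1 by omega]
    push_cast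
    ring
  have hkn : σ.reg 8 ≤ 2 * n := h.k_le.trans (Nat.mul_le_mul_left 2 (optAt_le hd i))
  have hkτ : σ.reg 8 * τ ≤ 2 * (optAt d i * τ) := by
    rw [← Nat.mul_assoc]; exact Nat.mul_le_mul_right _ h.k_le
  have hkτn : σ.reg 8 * τ ≤ 2 * (n * τ) := by
    rw [← Nat.mul_assoc]; exact Nat.mul_le_mul_right _ hkn
  refine (Runs.ite (t := n * (120 * (σ.reg 8 * τ) + 40) + 48 * (σ.reg 8 * τ) +
    4 * σ.reg 8 * (17 * n + 25) + 40) (fun hc => ?_) (fun hc => ?_)).mono ?_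
    (fun _ => le_rfl) le_rfl
  · replace hc : 0 < σ.reg 7 := by rw [← h.fixed.r5]; exact hc
    refine (runs_roundProg h.fixed hτ (by rw [h.r6]; exact i.2) h.u_le hc rfl (by omega) _
      (fun S => (failInd (RoundOk d i r σ) + (((R - (r + 1) : ℕ) : ℝ≥0∞) * ε + c)) +
        badSum d i (σ.reg 8) (σ.reg 8 * τ) (rd σ.mem 0 (σ.reg 7)) S) ?_).mono le_rfl
        (fun _ => le_rfl) ?_
    · intro σ' S hp
      rw [guarded_pos (h.step hd hp)]
      refine (add_le_add_left (failInd_roundOk_le h hp) _).trans (le_of_eq ?_)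
      ring
    · have hU : rd σ.mem 0 (σ.reg 7) ≠ [] := by
        intro h0
        have := congrArg List.length h0
        rw [rd_length] at this
        simp at this
        omega
      rw [sampleAvg_add, sampleAvg_const hU]
      have hb := failure_bound hn h.k_pos hL
      rw [← hτL, ← hε] at hb
      have h1 := (sampleAvg_badSum_le (d := d) (i := i) (t := σ.reg 8 * τ) hU).trans hb
      refine (add_le_add_right h1 _).trans (le_of_eq ?_)
      rw [hRr]
      ring
  -- Nothing is left to cover, so the round is skipped; the inequality of `RoundOk` then has left
  -- side 0.
  · replace hc : σ.reg 7 = 0 := by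
      have : ¬ σ.reg 5 < σ.reg 7 := hc
      rw [h.fixed.r5] at this
      omega
    refine (Det.runs (t := 1) (Det.block (l := []) (by simp) (Q := fun σ' => σ' = σ.set 20 0) (by
      simp [applyAll])) ?_).mono (by omega) (fun _ => le_rfl) le_rfl
    rintro σ' rfl
    have hinv : RoundInv d τ R i (r + 1) ((σ.set 20 0).set 9 (r + 1)) := by
      refine ⟨?_, ?_, ?_, ?_, ?_, ?_, ?_, ?_, ?_, ?_, ?_⟩
      · refine h.fixed.congr fun q hq => ?_
        rw [St.set_reg, if_neg (by omega), St.set_reg, if_neg (by omega)]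
      · simpa [St.set_reg] using h.r6
      · simp [St.set_reg]
      · simpa [St.set_reg] using h.u_le
      · simpa [St.set_reg, St.set_mem] using h.mem_U
      · simpa [St.set_reg] using h.k_pos
      · simpa [St.set_reg] using h.k_le
      · simpa [St.set_reg, St.set_mem, St.set_out] using h.covered
      · rw [Nat.succ_mul]
        exact h.deg.trans (Nat.le_add_right _ _)
      · exact h.prev
      · exact h.next
    rw [guarded_pos ⟨hinv, by simp [St.set_reg, h.r9], by simp [St.set_reg, h.fixed.r1]⟩]
    refine add_le_add (failInd_mono fun h0 => ⟨h0.1, ?_⟩) (add_le_add_left ?_ _)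
    · simp [St.set_reg, hc]
    · rw [hRr]; exact le_add_self
  · unfold roundTime
    have h1 := Nat.mul_le_mul_left n (show 120 * (σ.reg 8 * τ) + 40 ≤ 240 * (optAt d i * τ) + 40 by
      omega)
    have h2 := Nat.mul_le_mul_right (17 * n + 25)
      (show 4 * σ.reg 8 ≤ 8 * optAt d i by have := h.k_le; omega)
    omega

/-- Stores all points except `reg 6` as the uncovered points. -/
def fillProg : Prog :=
  .seq (.instr (.const 7 0)) (forLoop 14 0
    (.ite (.eq 14 6) (block []) (block [.store 7 14, .arith .add 7 7 1])))

lemma det_fillProg {σ : St n} {τ R : ℕ} (hG : Fixed τ R σ) (hW : n < W) :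
    Det W d fillProg (n * 9 + 5) σ fun σ' =>
      (∀ r < 14, r ≠ 7 → σ'.reg r = σ.reg r) ∧ σ'.out = σ.out ∧
      rd σ'.mem 0 (σ'.reg 7) = (List.range n).filter (fun x => x ≠ σ.reg 6) := by
  refine (Det.seq (Q := fun σ' => σ' = σ.set 7 0)
    (Det.instr (by simp [Instr.IsDet]) (by simp [Instr.apply])) (t := n * 9 + 3)
    fun σ' h => ?_).mono (by omega) fun _ => id
  subst h
  refine (Det.forLoop (N := n) hW 6 (fun j σ' => (∀ r < 14, r ≠ 7 → σ'.reg r = σ.reg r) ∧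
    σ'.out = σ.out ∧ σ'.reg 14 = j ∧
    rd σ'.mem 0 (σ'.reg 7) = (List.range j).filter (fun x => x ≠ σ.reg 6)) ?_ ?_ ?_).mono le_rfl ?_
  · refine ⟨fun r hr h7 => ?_, rfl, ?_, ?_⟩
    · rw [St.set_reg, if_neg (by omega), St.set_reg, if_neg (by omega)]
    · simp [St.set_reg]
    · simp [St.set_reg]
  · rintro j σ' ⟨hf, -, h14, -⟩
    exact ⟨h14, (hf 0 (by norm_num) (by norm_num)).trans hG.r0⟩
  · rintro j hj σ' ⟨hf, ho, h14, hU⟩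
    have e1 := (hf 1 (by norm_num) (by norm_num)).trans hG.r1
    have e6 := hf 6 (by norm_num) (by norm_num)
    have h7 : σ'.reg 7 ≤ j := by
      have h1 := congrArg List.length hU
      have h2 := List.length_filter_le (fun x => decide (x ≠ σ.reg 6)) (List.range j)
      rw [rd_length] at h1
      rw [List.length_range] at h2
      omega
    have u1 : (σ'.reg 7 + 1) % W = σ'.reg 7 + 1 := Nat.mod_eq_of_lt (by omega)
    refine Det.ite (t := 5) (fun h => ?_) (fun h => ?_)
    · replace h : j = σ.reg 6 := by rw [← h14, ← e6]; exact h
      refine (Det.block (by simp) ?_).mono (by simp) fun _ => id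
      simp only [applyAll, St.set_reg, St.set_mem, St.set_out, Nat.reduceEqDiff, reduceIte]
      refine ⟨⟨fun r hr h7r => ?_, ho, trivial, ?_⟩, h14, e1⟩
      · rw [if_neg (by omega), if_neg (by omega), hf r hr h7r]
      · rw [hU, List.range_succ, List.filter_append]
        simp [h]
    · replace h : j ≠ σ.reg 6 := by rw [← h14, ← e6]; exact h
      refine Det.block (by simp [Instr.IsDet]) ?_
      simp only [applyAll, Instr.apply, Op.eval, St.set_reg, St.set_mem, St.set_out,
        Nat.reduceEqDiff, reduceIte]
      rw [e1, u1, h14]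
      refine ⟨⟨fun r hr h7r => ?_, ho, trivial, ?_⟩, rfl, rfl⟩
      · rw [if_neg (by omega), if_neg (by omega), if_neg (by omega), hf r hr h7r]
      · rw [rd_succ, Nat.zero_add, Function.update_self, List.range_succ, List.filter_append, ← hU]
        congr 1
        · exact rd_congr fun t ht => Function.update_of_ne (by omega) _ _
        · simp [h]
  · rintro σ' ⟨hf, ho, -, hU⟩
    exact ⟨hf, ho, hU⟩

/-- Computes and outputs the out-neighbours of point `reg 6`. -/
def pointProg : Prog :=
  .seq fillProg (.seq (.instr (.const 8 1))
    (forLoop 9 3 (.ite (.lt 5 7) roundProg (block []))))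

/-- What surely holds after the points before `i` have been treated. -/
structure PointInv (d : Fin n → Fin n → ℝ) (τ R : ℕ) (i : ℕ) (σ : St n) : Prop where
  fixed : Fixed τ R σ
  r6 : σ.reg 6 = i
  prev : ∀ j : Fin n, (j : ℕ) < i → (outNbrs σ.out j).card ≤ R * (8 * optAt d j)
  next : ∀ e ∈ σ.out, (e.1 : ℕ) < i

/-- The time for a point with set cover optimum `o`. -/
def pointTime (n τ R o : ℕ) : ℕ := n * 9 + 11 + R * (roundTime n τ o + 3)

/-- The allowance R · ε of this point is spent by its R rounds. Surely at most R · 8 · OPT_i edges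
leave i; in the absence of failure U ends up empty, so i is done. -/
lemma runs_pointProg (hd : IsDistance d) {τ R L i : ℕ} {σ : St n} {ε : ℝ≥0∞}
    (hτ : 0 < τ) (hτL : τ = 28 * L) (hn : 2 ≤ n) (hL : n ≤ 2 ^ L) (hε : ε = ((n : ℝ≥0∞) ^ 6)⁻¹)
    (hR : 2 * n * n < 2 ^ R) (hRW : R < W) (hW : 6 * n + 8 * (n * τ) < W) (hi : i < n)
    (h : PointInv d τ R i σ) :
    Runs W d pointProg (pointTime n τ R (optAt d ⟨i, hi⟩)) σ
      (guarded (fun σ' => PointInv d τ R (i + 1) (σ'.set 6 (i + 1)) ∧ σ'.reg 6 = i ∧ σ'.reg 1 = 1)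
        fun σ' => failInd (NavBelow d (i + 1) (σ'.set 6 (i + 1)).out) +
          ((n - (i + 1) : ℕ) : ℝ≥0∞) * (R * ε))
      (failInd (NavBelow d i σ.out) + ((n - i : ℕ) : ℝ≥0∞) * (R * ε)) := by
  refine (Det.seq_runs (t := 5 + R * (roundTime n τ (optAt d ⟨i, hi⟩) + 3))
    (det_fillProg h.fixed (by omega)) ?_).mono (by unfold pointTime; omega) (fun _ => le_rfl) le_rfl
  rintro σ1 ⟨hf1, ho1, hU1⟩
  refine (Det.seq_runs (s := 1) (t := 3 + R * (roundTime n τ (optAt d ⟨i, hi⟩) + 3))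
    (Q := fun σ2 => σ2 = σ1.set 8 1) (Det.instr (by simp [Instr.IsDet]) (by
      rw [Instr.apply, Nat.mod_eq_of_lt (by omega)])) ?_).mono (by omega)
      (fun _ => le_rfl) le_rfl
  rintro σ2 rfl
  rw [h.r6] at hU1
  have hG1 : Fixed τ R σ1 := h.fixed.congr fun r hr => hf1 r (by omega) (by omega)
  have h71 : σ1.reg 7 ≤ n := by
    have h1 := congrArg List.length hU1
    have h2 := List.length_filter_le (fun x => decide (x ≠ i)) (List.range n)
    rw [rd_length] at h1
    rw [List.length_range] at h2
    omega
  have hcard : (outNbrs σ.out ⟨i, hi⟩).card = 0 := by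
    rw [Finset.card_eq_zero, Finset.eq_empty_iff_forall_notMem]
    intro k hk
    simp only [outNbrs, Finset.mem_filter, Finset.mem_univ, true_and] at hk
    exact lt_irrefl _ (h.next _ hk)
  have hloop := Runs.forLoop (W := W) (d := d) (c := 9) (lim := 3) (N := R) (σ := σ1.set 8 1)
    (body := .ite (.lt 5 7) roundProg (block [])) hRW (fun _ => roundTime n τ (optAt d ⟨i, hi⟩))
    (fun r σ' => RoundInv d τ R ⟨i, hi⟩ r σ')
    (fun r σ' => failInd (RoundOk d i r σ') + (((R - r : ℕ) : ℝ≥0∞) * ε +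
      ((n - (i + 1) : ℕ) : ℝ≥0∞) * (R * ε))) ?_ ?_ ?_
  · refine hloop.mono ?_ (fun σ' => le_guarded fun h' => ?_) ?_
    · simp; omega
    · have hinv : PointInv d τ R (i + 1) (σ'.set 6 (i + 1)) := by
        refine ⟨?_, by simp [St.set_reg], fun j hj => ?_, fun e he => ?_⟩
        · exact h'.fixed.congr fun q hq => by rw [St.set_reg, if_neg (by omega)]
        · rcases lt_or_eq_of_le (Nat.le_of_lt_succ hj) with hj | hj
          · exact h'.prev j hj
          · have : j = ⟨i, hi⟩ := Fin.ext hj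
            rw [this]
            exact h'.deg
        · exact Nat.lt_succ_of_le (h'.next e he)
      rw [guarded_pos ⟨hinv, h'.r6, h'.fixed.r1⟩]
      refine add_le_add (failInd_mono fun hok => ?_) le_add_self
      rw [St.set_out]
      -- |U| · 2^R ≤ n · k ≤ 2n² < 2^R.
      have hu0 : σ'.reg 7 = 0 := by
        by_contra hne
        have h1 : 1 * 2 ^ R ≤ σ'.reg 7 * 2 ^ R := Nat.mul_le_mul_right _ (by omega)
        have h2 : n * σ'.reg 8 ≤ n * (2 * n) :=
          Nat.mul_le_mul_left _ (h'.k_le.trans (Nat.mul_le_mul_left 2 (optAt_le hd _)))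
        have h3 := hok.2
        have h4 : n * (2 * n) = 2 * n * n := by ring
        omega
      intro j hj x hx
      rcases lt_or_eq_of_le (Nat.le_of_lt_succ hj) with hj | hj
      · exact hok.1 j hj x hx
      · have hji : j = ⟨i, hi⟩ := Fin.ext hj
        subst hji
        rcases h'.covered x x.2 (fun hxi => hx (Fin.ext hxi.symm)) with hU | ⟨p, hp, _, _, _, hlt⟩
        · rw [hu0] at hU; simp at hU
        · exact ⟨p, hp, by rw [hd.symm p x, hd.symm _ x]; exact hlt⟩
    · have e : ((n - i : ℕ) : ℝ≥0∞) = 1 + ((n - (i + 1) : ℕ) : ℝ≥0∞) := by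
        rw [show n - i = 1 + (n - (i + 1)) by omega]
        push_cast
        rfl
      rw [e, add_mul, one_mul, Nat.sub_zero]
      refine add_le_add_left (failInd_mono fun h0 => ⟨?_, ?_⟩) _
      · rw [St.set_out, St.set_out, ho1]; exact h0
      · simpa [St.set_reg] using h71
  · have g : ∀ r < 14, r ≠ 7 → r ≠ 8 → r ≠ 9 → ((σ1.set 8 1).set 9 0).reg r = σ.reg r :=
      fun r hr h7 h8 h9 => by
        rw [St.set_reg, if_neg h9, St.set_reg, if_neg h8, hf1 r hr h7]
    have hm : ((σ1.set 8 1).set 9 0).mem = σ1.mem := rfl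
    have ho : ((σ1.set 8 1).set 9 0).out = σ.out := ho1
    have g7 : ((σ1.set 8 1).set 9 0).reg 7 = σ1.reg 7 := by simp [St.set_reg]
    have g8 : ((σ1.set 8 1).set 9 0).reg 8 = 1 := by simp [St.set_reg]
    refine ⟨?_, ?_, ?_, ?_, ?_, ?_, ?_, ?_, ?_, ?_, ?_⟩
    · exact h.fixed.congr fun q hq => g q (by omega) (by omega) (by omega) (by omega)
    · rw [g 6 (by norm_num) (by norm_num) (by norm_num) (by norm_num), h.r6]
    · simp [St.set_reg]
    · rw [g7]; exact h71
    · rw [g7, hm, hU1]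
      intro x hx
      simpa using hx
    · rw [g8]
    · rw [g8]
      have := optAt_pos hd hn ⟨i, hi⟩
      omega
    · rw [g7, hm, hU1]
      intro x hx hxi
      left
      simpa using ⟨hx, hxi⟩
    · rw [ho, hcard]; exact Nat.zero_le _
    · rw [ho]; exact fun j hj => h.prev j hj
    · rw [ho]; exact fun e he => (h.next e he).le
  · rintro r σ' h'
    exact ⟨h'.r9, h'.fixed.r3⟩
  · intro r hr σ' h'
    exact runs_round hd hτ hτL hn hL hε hW hr h'

end

/-! ### The bound OPT* = O(n^1.5 log n) -/

section
variable {n : ℕ} {d : Fin n → Fin n → ℝ}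

/-- Nearest points are added one at a time; general position makes the comparison with the excluded
points strict. -/
lemma exists_nearest (hg : GeneralPosition d) (j : Fin n) (m : ℕ) (hm : m ≤ n) :
    ∃ B : Finset (Fin n), B.card = m ∧ ∀ b ∈ B, ∀ i ∉ B, d j b < d j i := by
  induction m with
  | zero => exact ⟨∅, rfl, by simp⟩
  | succ m ih =>
    obtain ⟨B, hB, hlt⟩ := ih (by omega)
    have hne : Bᶜ.Nonempty := by
      rw [← Finset.card_pos, Finset.card_compl, Fintype.card_fin]
      omega
    obtain ⟨a, ha, hmin⟩ := Finset.exists_min_image Bᶜ (d j) hne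
    rw [Finset.mem_compl] at ha
    refine ⟨insert a B, by rw [Finset.card_insert_of_notMem ha, hB], fun b hb i hi => ?_⟩
    rw [Finset.mem_insert, not_or] at hi
    rcases Finset.mem_insert.1 hb with rfl | hb
    · exact lt_of_le_of_ne (hmin i (Finset.mem_compl.2 hi.2)) (hg j b i (Ne.symm hi.1))
    · exact hlt b hb i hi.2

/-- Probabilistic method by counting: if no mL-tuple hits every `B j`, each of the n^(mL) tuples
avoids some `B j`, so n^(mL) ≤ n · (n - m)^(mL). But (1 - m/n)^(mL) ≤ e^(-L) < 2^(-L) ≤ 1/n, using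
m² ≥ n. -/
lemma exists_hitting {m L : ℕ} (hn : 0 < n) (hmn : n ≤ m * m) (hm : m ≤ n) (hL : n ≤ 2 ^ L)
    (hL1 : 1 ≤ L) (B : Fin n → Finset (Fin n)) (hB : ∀ j, (B j).card = m) :
    ∃ H : Finset (Fin n), H.card ≤ m * L ∧ ∀ j, ∃ h ∈ H, h ∈ B j := by
  by_contra hcon
  push Not at hcon
  have hall : ∀ F : Fin (m * L) → Fin n, ∃ j, ∀ t, F t ∉ B j := by
    intro F
    obtain ⟨j, hj⟩ := hcon (Finset.univ.image F)
      (Finset.card_image_le.trans (by simp))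
    exact ⟨j, fun t => hj _ (Finset.mem_image_of_mem F (Finset.mem_univ t))⟩
  have hcard : n ^ (m * L) ≤ n * (n - m) ^ (m * L) := by
    have h1 : (Finset.univ : Finset (Fin (m * L) → Fin n)) ⊆
        Finset.univ.biUnion fun j => Fintype.piFinset fun _ => (B j)ᶜ := by
      intro F _
      obtain ⟨j, hj⟩ := hall F
      simp only [Finset.mem_biUnion, Finset.mem_univ, true_and, Fintype.mem_piFinset,
        Finset.mem_compl]
      exact ⟨j, hj⟩
    have h2 := (Finset.card_le_card h1).trans Finset.card_biUnion_le
    simpa [Fintype.card_piFinset, Finset.card_compl, hB] using h2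
  have hn0 : (0 : ℝ) < n := by exact_mod_cast hn
  have hr : (n : ℝ) ^ (m * L) ≤ n * ((n : ℝ) - m) ^ (m * L) := by
    have : ((n ^ (m * L) : ℕ) : ℝ) ≤ ((n * (n - m) ^ (m * L) : ℕ) : ℝ) := by exact_mod_cast hcard
    push_cast [Nat.cast_sub hm] at this
    exact this
  have h3 : ((n : ℝ) - m) ^ (m * L) ≤ n ^ (m * L) * Real.exp (-L) := by
    have h4 : (n : ℝ) - m ≤ n * Real.exp (-(m / n)) := by
      have := Real.add_one_le_exp (-((m : ℝ) / n))
      calc (n : ℝ) - m = n * (-(m / n) + 1) := by field_simp; ring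
        _ ≤ _ := by gcongr
    have h0 : (0 : ℝ) ≤ (n : ℝ) - m := sub_nonneg.2 (by exact_mod_cast hm)
    calc ((n : ℝ) - m) ^ (m * L) ≤ (n * Real.exp (-(m / n))) ^ (m * L) := by gcongr
      _ = n ^ (m * L) * Real.exp ((m * L : ℕ) * (-(m / n))) := by rw [mul_pow, Real.exp_nat_mul]
      _ ≤ _ := by
        gcongr
        have : (L : ℝ) ≤ (m * m / n) * L := by
          have : (1 : ℝ) ≤ m * m / n := by
            rw [le_div_iff₀ hn0, one_mul]
            exact_mod_cast hmn
          nlinarith [(Nat.cast_nonneg L : (0 : ℝ) ≤ L)]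
        push_cast
        calc (m * L : ℝ) * (-(m / n)) = -((m * m / n) * L) := by ring
          _ ≤ _ := by linarith
  have h5 : (n : ℝ) * Real.exp (-L) < 1 := by
    have h6 : (2 : ℝ) ^ L < Real.exp L := by
      have := Real.exp_one_gt_d9
      rw [show (L : ℝ) = L * 1 by ring, Real.exp_nat_mul]
      exact pow_lt_pow_left₀ (by linarith) (by norm_num) (by omega)
    rw [Real.exp_neg, ← div_eq_mul_inv, div_lt_one (Real.exp_pos _)]
    exact lt_of_le_of_lt (by exact_mod_cast hL) h6
  have h7 : (0 : ℝ) < n ^ (m * L) := by positivity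
  have h8 : (n : ℝ) ^ (m * L) ≤ n ^ (m * L) * (n * Real.exp (-L)) := by
    calc (n : ℝ) ^ (m * L) ≤ n * ((n : ℝ) - m) ^ (m * L) := hr
      _ ≤ n * (n ^ (m * L) * Real.exp (-L)) := by gcongr
      _ = _ := by ring
  have h9 := mul_lt_mul_of_pos_left h5 h7
  linarith

/-- If i is among the m nearest points of j, the edge (i, j) serves. Otherwise a member of H among
these nearest points is strictly closer to j than i is. -/
lemma optEdges_le {m L : ℕ} (hd : IsDistance d) (hg : GeneralPosition d) (hn : 0 < n)
    (hmn : n ≤ m * m) (hm : m ≤ n) (hL : n ≤ 2 ^ L) (hL1 : 1 ≤ L) :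
    optEdges d ≤ n * (m * L) + n * m := by
  classical
  choose B hB hlt using fun j => exists_nearest hg j m hm
  obtain ⟨H, hH, hhit⟩ := exists_hitting hn hmn hm hL hL1 B hB
  let E : Finset (Fin n × Fin n) := Finset.univ ×ˢ H ∪
    Finset.univ.biUnion fun j => (B j).image fun i => (i, j)
  have hE : Navigable d E := by
    intro i j hij
    by_cases hi : i ∈ B j
    · refine ⟨j, Finset.mem_union_right _ (Finset.mem_biUnion.2 ⟨j, Finset.mem_univ _,
        Finset.mem_image.2 ⟨i, hi, rfl⟩⟩), ?_⟩
      rw [hd.self]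
      exact hd.pos i j hij
    · obtain ⟨h, hh, hhB⟩ := hhit j
      refine ⟨h, Finset.mem_union_left _ (by simp [hh]), ?_⟩
      rw [hd.symm h j, hd.symm i j]
      exact hlt j h hhB i hi
  have hcard : E.card ≤ n * (m * L) + n * m := by
    refine (Finset.card_union_le _ _).trans (add_le_add ?_ ?_)
    · rw [Finset.card_product, Finset.card_univ, Fintype.card_fin]
      exact Nat.mul_le_mul_left _ hH
    · refine Finset.card_biUnion_le.trans ?_
      calc ∑ j, ((B j).image fun i => (i, j)).card ≤ ∑ _j : Fin n, m :=
            Finset.sum_le_sum fun j _ => Finset.card_image_le.trans (hB j).le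
        _ = n * m := by simp
  have hle : optEdges d ≤ E.card := Nat.sInf_le ⟨E, hE, rfl⟩
  exact hle.trans hcard

lemma le_optEdges (hd : IsDistance d) (hn : 2 ≤ n) : n ≤ optEdges d := by
  refine le_trans ?_ (sum_optAt_le hd)
  calc n = ∑ _i : Fin n, 1 := by simp
    _ ≤ _ := Finset.sum_le_sum fun i _ => optAt_pos hd hn i

lemma optEdges_le_sq (hd : IsDistance d) : optEdges d ≤ n ^ 2 := by
  obtain ⟨E, -, hc⟩ := exists_navigable hd
  rw [← hc, pow_two]
  simpa using E.card_le_univ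

lemma clog_le_log {n : ℕ} (hn : 2 ≤ n) : (Nat.clog 2 n : ℝ) ≤ 4 * Real.log n := by
  have h1 := Nat.pow_pred_clog_lt_self (b := 2) (by norm_num) (by omega : 1 < n)
  have hpos : 0 < Nat.clog 2 n := Nat.clog_pos (by norm_num) hn
  have h2 : ((2 : ℝ) ^ (Nat.clog 2 n).pred) ≤ n := by exact_mod_cast h1.le
  have h3 := Real.log_le_log (by positivity) h2
  rw [Real.log_pow] at h3
  have h4 : ((Nat.clog 2 n).pred : ℝ) = (Nat.clog 2 n : ℝ) - 1 := by
    rw [Nat.pred_eq_sub_one, Nat.cast_sub hpos]; simp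
  have h5 : Real.log 2 ≤ Real.log n :=
    Real.log_le_log (by norm_num) (by exact_mod_cast hn)
  have h6 := Real.log_two_gt_d9
  rw [h4] at h3
  have h7 : (1 : ℝ) ≤ Nat.clog 2 n := by exact_mod_cast hpos
  nlinarith

lemma optEdges_le_rpow (hd : IsDistance d) (hg : GeneralPosition d) (hn : 2 ≤ n) :
    (n : ℝ) * optEdges d ≤ 16 * ((n : ℝ) ^ (2.5 : ℝ) * Real.log n) := by
  have hpos : 0 < Nat.clog 2 n := Nat.clog_pos (by norm_num) hn
  -- This m satisfies n ≤ m², m ≤ n and m ≤ 2√n.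
  have h1 := optEdges_le (m := Nat.sqrt n + 1) hd hg (by omega) (Nat.lt_succ_sqrt n).le
    (Nat.sqrt_lt_self (by omega)) (Nat.le_pow_clog (by norm_num) n) hpos
  have h2 : (optEdges d : ℝ) ≤ n * ((Nat.sqrt n + 1) * Nat.clog 2 n) + n * (Nat.sqrt n + 1) := by
    exact_mod_cast h1
  have hn0 : (0 : ℝ) < n := by positivity
  have h3 : (Nat.sqrt n : ℝ) + 1 ≤ 2 * √n := by
    have h4 : (Nat.sqrt n : ℝ) ≤ √n := Real.nat_sqrt_le_real_sqrt
    have h5 : (1 : ℝ) ≤ √n := by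
      rw [Real.one_le_sqrt]; exact_mod_cast (by omega : 1 ≤ n)
    linarith
  have h6 : (1 : ℝ) ≤ Nat.clog 2 n := by exact_mod_cast hpos
  have h7 := clog_le_log hn
  have h8 : (n : ℝ) ^ (2.5 : ℝ) = n * n * √n := by
    rw [Real.sqrt_eq_rpow, ← pow_two, ← Real.rpow_natCast, ← Real.rpow_add hn0]
    norm_num
  have hs := Real.sqrt_nonneg (n : ℝ)
  calc (n : ℝ) * optEdges d
      ≤ n * (n * ((Nat.sqrt n + 1) * Nat.clog 2 n) + n * (Nat.sqrt n + 1)) := by gcongr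
    _ = n * n * ((Nat.sqrt n + 1) * (Nat.clog 2 n + 1)) := by ring
    _ ≤ n * n * ((2 * √n) * (2 * (4 * Real.log n))) := by
        gcongr
        linarith
    _ = 16 * ((n : ℝ) ^ (2.5 : ℝ) * Real.log n) := by rw [h8]; ring

end

/-! ### The whole program: set-up, running time and failure probability -/

section
variable {n : ℕ} {W : ℕ} {d : Fin n → Fin n → ℝ}

/-- Computes the contents of the fixed registers. -/
def initProg : Prog :=
  .seq (block [.const 1 1, .const 17 1])
    (.seq (forLoop 16 0 (.ite (.lt 17 0) (block [.arith .add 17 17 17, .arith .add 2 2 1]) (block [])))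
      (block [.arith .add 3 2 2, .arith .add 3 3 1, .arith .add 3 3 1, .const 17 28,
        .arith .mul 2 2 17, .arith .add 4 0 0]))

/-- Register 17 is doubled and register 2 incremented as long as the former is below n, so register
2 stops at ⌈log₂ n⌉; n iterations are enough since ⌈log₂ n⌉ ≤ n. -/
lemma det_initProg {σ : St n} (hn : 2 ≤ n) (h0 : σ.reg 0 = n) (h2 : σ.reg 2 = 0) (h5 : σ.reg 5 = 0)
    (hW : 2 * n + 28 * Nat.clog 2 n + 30 < W) :
    Det W d initProg (9 * n + 23) σ fun σ' =>
      Fixed (28 * Nat.clog 2 n) (2 * Nat.clog 2 n + 2) σ' ∧ σ'.out = σ.out := by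
  set L := Nat.clog 2 n with hL
  have w1 : 1 % W = 1 := Nat.mod_eq_of_lt (by omega)
  refine (Det.seq (s := 5) (t := 9 * n + 17) (Q := fun σ1 => σ1.reg 0 = n ∧ σ1.reg 1 = 1 ∧
    σ1.reg 2 = 0 ∧ σ1.reg 5 = 0 ∧ σ1.reg 17 = 1 ∧ σ1.out = σ.out)
    (Det.block (l := [.const 1 1, .const 17 1]) (by simp [Instr.IsDet]) ?_) ?_).mono (by omega)
    fun _ => id
  · simp only [applyAll, Instr.apply, St.set_reg, St.set_out, Nat.reduceEqDiff, reduceIte, w1, h0,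
      h2, h5, OfNat.zero_ne_ofNat, zero_ne_one, OfNat.one_ne_ofNat, and_self]
  rintro σ1 ⟨k0, k1, k2, k5, k17, ko⟩
  refine (Det.seq (s := n * 9 + 3) (t := 13) (Q := fun σ2 => σ2.reg 0 = n ∧ σ2.reg 1 = 1 ∧
    σ2.reg 2 = L ∧ σ2.reg 5 = 0 ∧ σ2.out = σ.out)
    ((Det.forLoop (N := n) (by omega) 6 (fun j σ2 => σ2.reg 0 = n ∧ σ2.reg 1 = 1 ∧
      σ2.reg 2 = min j L ∧ σ2.reg 5 = 0 ∧ σ2.reg 17 = 2 ^ (min j L) ∧ σ2.out = σ.out ∧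
      σ2.reg 16 = j) ?_ ?_ ?_).mono le_rfl ?_) ?_).mono (by omega) fun _ => id
  · simp [St.set_reg, St.set_out, k0, k1, k2, k5, k17, ko]
  · rintro j σ' ⟨g0, g1, g2, g5, g17, go, g16⟩
    exact ⟨g16, g0⟩
  · rintro j hj σ' ⟨g0, g1, g2, g5, g17, go, g16⟩
    refine Det.ite (t := 5) (fun h => ?_) (fun h => ?_)
    · change σ'.reg 17 < σ'.reg 0 at h
      rw [g17, g0] at h
      have hjL : j < L := by
        by_contra hc
        rw [min_eq_right (not_lt.1 hc)] at h
        exact absurd (Nat.le_pow_clog (b := 2) (by norm_num) n) (not_le.2 h)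
      rw [min_eq_left hjL.le] at g2 g17 h
      have u1 : (2 ^ j + 2 ^ j) % W = 2 ^ (j + 1) := by
        rw [Nat.mod_eq_of_lt (by omega)]; ring
      have u2 : (j + 1) % W = j + 1 := Nat.mod_eq_of_lt (by omega)
      refine Det.block (by simp [Instr.IsDet]) ?_
      rw [min_eq_left hjL]
      simp [applyAll, Instr.apply, Op.eval, St.set_reg, St.set_out, g0, g1, g2, g5, g17, go, g16,
        u1, u2]
    · change ¬ σ'.reg 17 < σ'.reg 0 at h
      rw [g17, g0] at h
      have hLj : L ≤ j := by
        by_contra hc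
        rw [min_eq_left (not_le.1 hc).le] at h
        have := Nat.clog_le_of_le_pow (not_lt.1 h)
        omega
      rw [min_eq_right hLj] at g2 g17
      refine (Det.block (by simp [Instr.IsDet]) ?_).mono (by simp) fun _ => id
      rw [min_eq_right (by omega)]
      simp [applyAll, Instr.apply, Op.eval, St.set_reg, St.set_out, g0, g1, g2, g5, g17, go, g16]
  · rintro σ' ⟨g0, g1, g2, g5, g17, go, g16⟩
    refine ⟨g0, g1, ?_, g5, go⟩
    rw [g2, min_eq_right]
    exact Nat.clog_le_of_le_pow (Nat.lt_two_pow_self).le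
  · rintro σ' ⟨g0, g1, g2, g5, go⟩
    have u1 : (L + L) % W = L + L := Nat.mod_eq_of_lt (by omega)
    have u2 : (L + L + 1) % W = L + L + 1 := Nat.mod_eq_of_lt (by omega)
    have u3 : (L + L + 1 + 1) % W = L + L + 1 + 1 := Nat.mod_eq_of_lt (by omega)
    have u4 : 28 % W = 28 := Nat.mod_eq_of_lt (by omega)
    have u5 : (L * 28) % W = L * 28 := Nat.mod_eq_of_lt (by omega)
    have u6 : (n + n) % W = n + n := Nat.mod_eq_of_lt (by omega)
    refine Det.block (by simp [Instr.IsDet]) ?_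
    refine ⟨⟨?_, ?_, ?_, ?_, ?_, ?_⟩, ?_⟩ <;>
      simp [applyAll, Instr.apply, Op.eval, St.set_reg, St.set_out, g0, g1, g2, g5, go, u1, u2, u3,
        u4, u5, u6] <;> omega

/-- The whole program. -/
def navProg : Prog := .seq initProg (forLoop 6 0 pointProg)

/-- The optimum of the set cover instance of the point with a given number. -/
noncomputable def optNat (d : Fin n → Fin n → ℝ) (i : ℕ) : ℕ :=
  if h : i < n then optAt d ⟨i, h⟩ else 0

/-- The running time of the program. -/
noncomputable def navTime (d : Fin n → Fin n → ℝ) : ℕ :=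
  9 * n + 27 + ∑ i ∈ Finset.range n,
    (pointTime n (28 * Nat.clog 2 n) (2 * Nat.clog 2 n + 2) (optNat d i) + 3)

lemma word_bound_large (hn : 2 ≤ n) :
    6 * n + 8 * (n * (28 * Nat.clog 2 n)) + 28 * Nat.clog 2 n + 30 < wordBound 10 n := by
  set L := Nat.clog 2 n with hL
  have h1 : n ≤ 2 ^ L := Nat.le_pow_clog (by norm_num) n
  have h2 : L < 2 ^ L := Nat.lt_two_pow_self
  have h3 : 2 ≤ 2 ^ L := hn.trans h1
  have h4 : wordBound 10 n = (2 ^ L) ^ 10 := by rw [wordBound, ← pow_mul, mul_comm]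
  rw [h4]
  set x := 2 ^ L
  have h5 : n * (28 * L) ≤ x * (28 * x) := Nat.mul_le_mul h1 (Nat.mul_le_mul_left _ h2.le)
  have h6 : 2 ^ 8 * x ^ 2 ≤ x ^ 10 := by
    calc 2 ^ 8 * x ^ 2 ≤ x ^ 8 * x ^ 2 := Nat.mul_le_mul_right _ (Nat.pow_le_pow_left h3 8)
      _ = x ^ 10 := by ring
  nlinarith

/-- The potential allows R · n⁻⁶ for each point not yet treated, and nothing has failed at the
start. The guard carries the sure degree bounds. -/
lemma runs_navProg (hd : IsDistance d) (hn : 2 ≤ n) {σ : St n} (h0 : σ.reg 0 = n)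
    (h2 : σ.reg 2 = 0) (h5 : σ.reg 5 = 0) (ho : σ.out = ∅) :
    Runs (wordBound 10 n) d navProg (navTime d) σ
      (guarded (fun σ' => ∀ j, (outNbrs σ'.out j).card ≤ (2 * Nat.clog 2 n + 2) * (8 * optAt d j))
        fun σ' => failInd (Navigable d σ'.out))
      ((n : ℝ≥0∞) * ((2 * Nat.clog 2 n + 2 : ℕ) * ((n : ℝ≥0∞) ^ 6)⁻¹)) := by
  set L := Nat.clog 2 n with hL
  have hW := word_bound_large hn
  rw [← hL] at hW
  have hpos : 0 < L := Nat.clog_pos (by norm_num) hn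
  have hnL : n ≤ 2 ^ L := Nat.le_pow_clog (by norm_num) n
  refine (Det.seq_runs (det_initProg hn h0 h2 h5 (by rw [← hL]; omega))
    (t := ∑ i ∈ Finset.range n, (pointTime n (28 * L) (2 * L + 2) (optNat d i) + 3) + 3)
    ?_).mono (by unfold navTime; rw [← hL]; omega) (fun _ => le_rfl) le_rfl
  rintro σ1 ⟨hG, ho1⟩
  rw [ho] at ho1
  refine (Runs.forLoop (N := n) (by omega)
    (fun i => pointTime n (28 * L) (2 * L + 2) (optNat d i))
    (fun i σ' => PointInv d (28 * L) (2 * L + 2) i σ')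
    (fun i σ' => failInd (NavBelow d i σ'.out) +
      ((n - i : ℕ) : ℝ≥0∞) * ((2 * L + 2 : ℕ) * ((n : ℝ≥0∞) ^ 6)⁻¹)) ?_ ?_ ?_).mono le_rfl ?_ ?_
  · refine ⟨?_, by simp [St.set_reg], by simp, by simp [St.set_out, ho1]⟩
    exact hG.congr fun q hq => by rw [St.set_reg, if_neg (by omega)]
  · rintro i σ' h
    exact ⟨h.r6, h.fixed.r0⟩
  · intro i hi σ' h
    have := runs_pointProg (W := wordBound 10 n) hd (τ := 28 * L) (by omega) rfl hn hnL rfl (by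
      -- This is 2n² < 2^R: the right side is at least 4n².
      have : 2 ^ (2 * L + 2) = 4 * (2 ^ L * 2 ^ L) := by ring
      have := Nat.mul_le_mul hnL hnL
      have : 0 < n * n := by positivity
      rw [Nat.mul_assoc]
      omega) (by omega) (by omega) hi h
    rw [optNat, dif_pos hi]
    exact this
  · refine fun σ' => le_guarded fun h => ?_
    rw [guarded_pos fun j => h.prev j j.2]
    refine le_trans (failInd_mono fun hb => ?_) le_self_add
    exact fun i j hij => hb i i.2 j hij
  · have : failInd (NavBelow d 0 (σ1.set 6 0).out) = 0 := by
      rw [failInd, if_pos]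
      exact fun j hj => absurd hj (Nat.not_lt_zero _)
    rw [this, zero_add, Nat.sub_zero]

lemma failure_total (hn : 2 ≤ n) :
    (n : ℝ≥0∞) * ((2 * Nat.clog 2 n + 2 : ℕ) * ((n : ℝ≥0∞) ^ 6)⁻¹) ≤
      ENNReal.ofReal (1 / (n : ℝ) ^ 2) := by
  have h1 : Nat.clog 2 n ≤ n := Nat.clog_le_of_le_pow (Nat.lt_two_pow_self).le
  have h2 : n * (2 * Nat.clog 2 n + 2) ≤ n ^ 4 := by
    have h3 : 2 * Nat.clog 2 n + 2 ≤ n ^ 3 := by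
      have : 4 * n ≤ n ^ 3 := by
        have : 2 * 2 ≤ n * n := Nat.mul_le_mul hn hn
        calc 4 * n ≤ (n * n) * n := Nat.mul_le_mul_right _ this
          _ = n ^ 3 := by ring
      omega
    calc n * (2 * Nat.clog 2 n + 2) ≤ n * n ^ 3 := Nat.mul_le_mul_left _ h3
      _ = n ^ 4 := by ring
  have hn0 : (0 : ℝ) < n := by positivity
  have hn1 : (n : ℝ≥0∞) ^ 4 ≠ 0 := by
    have : (n : ℝ≥0∞) ≠ 0 := by exact_mod_cast (by omega : n ≠ 0)
    exact pow_ne_zero _ this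
  rw [one_div, ENNReal.ofReal_inv_of_pos (by positivity), ENNReal.ofReal_pow hn0.le,
    ENNReal.ofReal_natCast, ← mul_assoc]
  calc (n : ℝ≥0∞) * (2 * Nat.clog 2 n + 2 : ℕ) * ((n : ℝ≥0∞) ^ 6)⁻¹
      ≤ (n : ℝ≥0∞) ^ 4 * ((n : ℝ≥0∞) ^ 6)⁻¹ := by
        gcongr
        exact_mod_cast h2
    _ = _ := by
        rw [show 6 = 4 + 2 by norm_num, pow_add, ENNReal.mul_inv (Or.inl hn1)
          (Or.inl (ENNReal.pow_ne_top (by simp))), ← mul_assoc,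
          ENNReal.mul_inv_cancel hn1 (ENNReal.pow_ne_top (by simp)), one_mul]

/-- A round at a point with optimum o takes O(n · o · L) steps and there are at most 4L rounds.
Summing over the points turns o into ∑ OPT_i ≤ OPT*. -/
lemma navTime_le (hd : IsDistance d) (hn : 2 ≤ n) :
    navTime d ≤ 50000 * (n * optEdges d) * Nat.clog 2 n ^ 2 := by
  set L := Nat.clog 2 n with hL
  have hpos : 1 ≤ L := Nat.clog_pos (by norm_num) hn
  have hpt : ∀ o, 1 ≤ o → pointTime n (28 * L) (2 * L + 2) o + 3 ≤ 40000 * n * L ^ 2 * o := by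
    intro o ho
    have a1 : 1 ≤ n * (o * L) := Nat.mul_pos (by omega) (Nat.mul_pos ho hpos)
    have a2 : n ≤ n * (o * L) := Nat.le_mul_of_pos_right _ (Nat.mul_pos ho hpos)
    have a3 : o * L ≤ n * (o * L) := Nat.le_mul_of_pos_left _ (by omega)
    have a4 : o ≤ o * L := Nat.le_mul_of_pos_right _ hpos
    have a5 : n * o ≤ n * (o * L) := Nat.mul_le_mul_left _ a4
    have h1 : roundTime n (28 * L) o + 3 ≤ 9828 * (n * (o * L)) := by
      have e : roundTime n (28 * L) o = 6720 * (n * (o * L)) + 40 * n + 2688 * (o * L) +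
          136 * (n * o) + 200 * o + 41 := by unfold roundTime; ring
      omega
    have h2 : 2 * L + 2 ≤ 4 * L := by omega
    have h3 := Nat.mul_le_mul h2 h1
    have e3 : 4 * L * (9828 * (n * (o * L))) = 39312 * (n * L ^ 2 * o) := by ring
    have h4 : n * (o * L) ≤ n * L ^ 2 * o := by
      calc n * (o * L) = n * o * L * 1 := by ring
        _ ≤ n * o * L * L := Nat.mul_le_mul_left _ hpos
        _ = _ := by ring
    have e4 : 40000 * n * L ^ 2 * o = 40000 * (n * L ^ 2 * o) := by ring
    unfold pointTime
    rw [e4]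
    omega
  have hsum : ∑ i ∈ Finset.range n, (pointTime n (28 * L) (2 * L + 2) (optNat d i) + 3) ≤
      40000 * n * L ^ 2 * optEdges d := by
    calc _ ≤ ∑ i ∈ Finset.range n, 40000 * n * L ^ 2 * optNat d i := by
          refine Finset.sum_le_sum fun i hi => hpt _ ?_
          rw [optNat, dif_pos (Finset.mem_range.1 hi)]
          exact optAt_pos hd hn _
      _ = 40000 * n * L ^ 2 * ∑ i : Fin n, optAt d i := by
          rw [← Finset.mul_sum, ← Fin.sum_univ_eq_sum_range]
          congr 1
          refine Finset.sum_congr rfl fun i _ => ?_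
          rw [optNat, dif_pos i.2]
      _ ≤ _ := Nat.mul_le_mul_left _ (sum_optAt_le hd)
  have h1 : n ≤ n * optEdges d * L ^ 2 := by
    have := le_optEdges hd hn
    rw [Nat.mul_assoc]
    exact Nat.le_mul_of_pos_right _ (Nat.mul_pos (by omega) (by positivity))
  have e1 : 40000 * n * L ^ 2 * optEdges d = 40000 * (n * optEdges d * L ^ 2) := by ring
  unfold navTime
  rw [← hL]
  calc _ ≤ 9 * n + 27 + 40000 * (n * optEdges d * L ^ 2) := by omega
    _ ≤ 50000 * (n * optEdges d * L ^ 2) := by omega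
    _ = _ := by ring

/-- From n ≤ OPT* ≤ n² the product n · OPT* lies between n² and n³, so all logarithms involved are
comparable. -/
lemma log_bounds (hd : IsDistance d) (hn : 2 ≤ n) :
    2 * Real.log n ≤ Real.log ((n : ℝ) * optEdges d) ∧
      Real.log ((n : ℝ) * optEdges d) ≤ 3 * Real.log n := by
  have hn0 : (0 : ℝ) < n := by positivity
  have h1 : (n : ℝ) ≤ optEdges d := by exact_mod_cast le_optEdges hd hn
  have h2 : (optEdges d : ℝ) ≤ (n : ℝ) ^ 2 := by exact_mod_cast optEdges_le_sq hd
  constructor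
  · rw [show 2 * Real.log n = Real.log ((n : ℝ) ^ 2) by rw [Real.log_pow]; norm_num]
    exact Real.log_le_log (by positivity) (by nlinarith)
  · rw [show 3 * Real.log n = Real.log ((n : ℝ) ^ 3) by rw [Real.log_pow]; norm_num]
    exact Real.log_le_log (by nlinarith) (by nlinarith)

/-- A finite cost excludes unhalted configurations of positive probability. Each remaining unit of
probability lies in `post` or is charged to the cost. -/
lemma haltsWithin_and_probability {p : Prog} {w T : ℕ} {ε : ℝ} {post : Set (Config n)}
    (hε : 0 ≤ ε)
    (h : cost (wordBound w n) d (fun s => failInd (s ∈ post)) T (initial n p) ≤ ENNReal.ofReal ε) :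
    HaltsWithin p w d T ∧ ENNReal.ofReal (1 - ε) ≤ (run p w d T).toOuterMeasure post := by
  classical
  have hfin : cost (wordBound w n) d (fun s => failInd (s ∈ post)) T (initial n p) ≠ ⊤ :=
    ne_top_of_le_ne_top ENNReal.ofReal_ne_top h
  constructor
  · intro s hs
    by_contra hc
    refine hfin (ENNReal.tsum_eq_top_of_eq_top ⟨s, ?_⟩)
    rw [if_neg hc, ENNReal.mul_top]
    exact (PMF.mem_support_iff _ _).1 hs
  · have h1 : (1 : ℝ≥0∞) ≤ (run p w d T).toOuterMeasure post + ENNReal.ofReal ε := by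
      rw [← (run p w d T).tsum_coe, PMF.toOuterMeasure_apply]
      refine le_trans ?_ (add_le_add_right h _)
      rw [cost, ← ENNReal.tsum_add]
      refine ENNReal.tsum_le_tsum fun s => ?_
      by_cases hs : s ∈ post
      · rw [Set.indicator_of_mem hs]; exact le_self_add
      · rw [Set.indicator_of_notMem hs, zero_add]
        have h2 : (1 : ℝ≥0∞) ≤ if s.todo = [] then failInd (s ∈ post) else ⊤ := by
          rw [failInd, if_neg hs]
          split_ifs <;> simp
        calc run p w d T s = run p w d T s * 1 := (mul_one _).symm
          _ ≤ _ := mul_le_mul_right h2 _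
    rw [ENNReal.ofReal_sub _ hε, ENNReal.ofReal_one]
    exact tsub_le_iff_right.2 h1

end
end NavGraph

theorem mainTheorem7 :
    ∃ (p : NavGraph.Prog) (w : ℕ) (A B K : ℝ) (a b : ℕ),
      ∀ (n : ℕ), 2 ≤ n → ∀ (d : Fin n → Fin n → ℝ),
        NavGraph.IsDistance d → NavGraph.GeneralPosition d →
        ∃ T : ℕ,
          NavGraph.HaltsWithin p w d T ∧
          (T : ℝ) ≤ A * ((n : ℝ) * (NavGraph.optEdges d : ℝ)) *
            Real.log ((n : ℝ) * (NavGraph.optEdges d : ℝ)) ^ a ∧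
          A * ((n : ℝ) * (NavGraph.optEdges d : ℝ)) *
            Real.log ((n : ℝ) * (NavGraph.optEdges d : ℝ)) ^ a ≤
            B * (n : ℝ) ^ (2.5 : ℝ) * Real.log ((n : ℝ) ^ (2.5 : ℝ)) ^ b ∧
          ENNReal.ofReal (1 - 1 / (n : ℝ) ^ 2) ≤
            (NavGraph.run p w d T).toOuterMeasure
              {s | NavGraph.Navigable d s.out ∧
                (s.out.card : ℝ) ≤ K * (NavGraph.optEdges d : ℝ) * Real.log n ∧
                ∀ i : Fin n, ((NavGraph.outNbrs s.out i).card : ℝ) ≤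
                  K * (NavGraph.optAt d i : ℝ) * Real.log n} := by
  open NavGraph in
  -- A = 50000 · 2² as ⌈log₂ n⌉ ≤ 2 log X with X = n · OPT*; B = A · 16 · 3² from OPT* = O(n^1.5 log
  -- n) and log X ≤ 3 log n; K = 16 · 8 from R ≤ 16 log n and at most 8 · OPT_i edges per round.
  refine ⟨navProg, 10, 200000, 28800000, 128, 2, 3, fun n hn d hd hg => ⟨navTime d, ?_⟩⟩
  have hn0 : (0 : ℝ) < n := by positivity
  have hlog0 : 0 ≤ Real.log n := Real.log_natCast_nonneg n
  have hclog := clog_le_log hn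
  have hpos : 1 ≤ Nat.clog 2 n := Nat.clog_pos (by norm_num) hn
  obtain ⟨hlow, hupp⟩ := log_bounds hd hn
  set X : ℝ := (n : ℝ) * optEdges d with hX
  have hX0 : 0 ≤ X := by positivity
  -- The calculus is applied with an empty continuation and no steps left over, so the cost is the
  -- final failure indicator.
  have hcost := runs_navProg (d := d) hd hn (σ := ⟨(initial n navProg).reg, fun _ => 0, ∅⟩)
    (by simp [initial]) (by simp [initial]) (by simp [initial]) rfl
    (fun s => failInd (s ∈ {s : Config n | Navigable d s.out ∧
      (s.out.card : ℝ) ≤ 128 * (optEdges d : ℝ) * Real.log n ∧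
      ∀ i : Fin n, ((outNbrs s.out i).card : ℝ) ≤ 128 * (optAt d i : ℝ) * Real.log n})) [] 0 (by
    intro σ'
    rw [cost_zero, if_pos (show (σ'.cfg []).todo = [] from rfl)]
    refine le_guarded fun hdeg => failInd_mono fun hnav => ?_
    have hR : (2 * Nat.clog 2 n + 2 : ℝ) ≤ 16 * Real.log n := by
      have : (1 : ℝ) ≤ Nat.clog 2 n := by exact_mod_cast hpos
      linarith
    have hdeg' : ∀ i : Fin n, ((outNbrs σ'.out i).card : ℝ) ≤
        128 * (optAt d i : ℝ) * Real.log n := fun i => by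
      have h1 : ((outNbrs σ'.out i).card : ℝ) ≤ (2 * Nat.clog 2 n + 2) * (8 * optAt d i) := by
        exact_mod_cast hdeg i
      refine h1.trans ?_
      calc (2 * Nat.clog 2 n + 2 : ℝ) * (8 * optAt d i) ≤ (16 * Real.log n) * (8 * optAt d i) := by
            gcongr
        _ = _ := by ring
    refine ⟨hnav, ?_, hdeg'⟩
    change ((σ'.out.card : ℕ) : ℝ) ≤ _
    rw [← sum_card_outNbrs, Nat.cast_sum]
    calc ∑ i, ((outNbrs σ'.out i).card : ℝ) ≤ ∑ i, 128 * (optAt d i : ℝ) * Real.log n :=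
          Finset.sum_le_sum fun i _ => hdeg' i
      _ = 128 * ((∑ i, optAt d i : ℕ) : ℝ) * Real.log n := by
          push_cast
          rw [Finset.mul_sum, Finset.sum_mul]
      _ ≤ _ := by
          gcongr
          exact sum_optAt_le hd)
  rw [Nat.zero_add] at hcost
  obtain ⟨hhalt, hprob⟩ := haltsWithin_and_probability (p := navProg) (by positivity)
    (hcost.trans (failure_total hn))
  refine ⟨hhalt, ?_, ?_, hprob⟩
  · have h1 : (navTime d : ℝ) ≤ 50000 * X * (Nat.clog 2 n : ℝ) ^ 2 := by
      rw [hX]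
      exact_mod_cast navTime_le hd hn
    have h2 : (Nat.clog 2 n : ℝ) ≤ 2 * Real.log X := by linarith
    calc (navTime d : ℝ) ≤ 50000 * X * (Nat.clog 2 n : ℝ) ^ 2 := h1
      _ ≤ 50000 * X * (2 * Real.log X) ^ 2 := by gcongr
      _ = _ := by ring
  · have h1 := optEdges_le_rpow hd hg hn
    rw [← hX] at h1
    have hl : Real.log ((n : ℝ) ^ (2.5 : ℝ)) = 2.5 * Real.log n := Real.log_rpow hn0 _
    have hlX : 0 ≤ Real.log X := by linarith
    rw [hl]
    calc 200000 * X * Real.log X ^ 2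
        ≤ 200000 * (16 * ((n : ℝ) ^ (2.5 : ℝ) * Real.log n)) * (3 * Real.log n) ^ 2 := by gcongr
      _ = 28800000 * (n : ℝ) ^ (2.5 : ℝ) * Real.log n ^ 3 := by ring
      _ ≤ _ := by
        gcongr
        linarith
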